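/- **Setting.** Let $\Pi$ (decisions) and $\mathcal O$ (observations) be measurable spaces. A *model* is a probability kernel $M:\Pi\to\Delta([0,1]\times\mathcal O)$, giving the joint law of the reward $r\in[0,1]$ and the observation $o$ for each decision; $\mathcal M^+$ is the set of all models. Write $f^M(\pi)=\mathbb E_{(r,o)\sim M(\pi)}[r]$ and $g^M(\pi)=\sup_{\pi'\in\Pi}f^M(\pi')-f^M(\pi)$. A $T$-round *algorithm* is a sequence $p=(p^1,\dots,p^T)$ of probability kernels, $p^t$ mapping the history $\mathfrak H^{t-1}=(\pi^s,r^s,o^s)_{s<t}$ to a distribution of $\pi^t\in\Pi$; against a model $M$ it draws $\pi^t\sim p^t(\cdot\mid\mathfrak H^{t-1})$ and then $(r^t,o^t)\sim M(\pi^t)$. With $\mathbb E^{M,p}$ the expectation under the resulting law of $\mathfrak H^T$, $$\mathbb E^{M,p}[\mathrm{Reg}(T)]=\mathbb E^{M,p}\Big[\sum_{t=1}^T\mathbb E_{\pi^t\sim p^t(\cdot\mid\mathfrak H^{t-1})}\big[g^M(\pi^t)\big]\Big].$$ For probability measures $P,Q$ dominated by $\nu$, let $D_H^2(P,Q)=\int\big(\sqrt{dP/d\nu}-\sqrt{dQ/d\nu}\big)^2d\nu$.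 For a class $\mathcal M\subseteq\mathcal M^+$, a reference model $\overline M\in\mathcal M^+$ and $\varepsilon>0$, the constrained (regret) decision-estimation coefficient is $$\mathrm{dec}^c_\varepsilon(\mathcal M,\overline M)=\inf_{p\in\Delta(\Pi)}\ \sup\Big\{\mathbb E_{\pi\sim p}[g^M(\pi)]\ :\ M\in\mathcal M,\ \mathbb E_{\pi\sim p}\big[D_H^2(M(\pi),\overline M(\pi))\big]\le\varepsilon^2\Big\},$$ where the supremum of the empty set is $0$, and $$\mathrm{dec}^c_\varepsilon(\mathcal M)=\sup_{\overline M\in\mathrm{co}(\mathcal M)}\mathrm{dec}^c_\varepsilon(\mathcal M\cup\{\overline M\},\overline M),$$ with $\mathrm{co}(\mathcal M)$ the convex hull of $\mathcal M$ (and the supremum of the empty set again $0$). Finally let $$V(\mathcal M)=\Big(\sup_{M,M'\in\mathcal M}\ \sup_{\pi\in\Pi}\ \sup_{A}\frac{M(A\mid\pi)}{M'(A\mid\pi)}\Big)\vee e\in[e,\infty],\qquad C(T)=\log\big(T\wedge V(\mathcal M)\big),$$ with $A$ ranging over the measurable subsets of $[0,1]\times\mathcal O$, and with $a/0=\infty$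 for $a>0$ and $0/0=0$. **Theorem (main lower bound: regret).** There exist universal constants $C,C'>0$ and $c,c'>0$ such that the following holds for all $\Pi$, $\mathcal O$, every model class $\mathcal M\subseteq\mathcal M^+$ and every integer $T\ge2$. Let $\varepsilon_T=c/\sqrt{T\,C(T)}$. If $$\mathrm{dec}^c_{\varepsilon_T}(\mathcal M)\ \ge\ C\,\varepsilon_T,$$ then for every algorithm $p$ there exists a model $M\in\mathcal M$ such that $$\mathbb E^{M,p}[\mathrm{Reg}(T)]\ \ge\ c'\cdot\sup_{\overline M\in\mathcal M^+}\mathrm{dec}^c_{\varepsilon_T}(\mathcal M\cup\{\overline M\},\overline M)\cdot\frac{T}{\log T}-C'\cdot\frac{\sqrt T}{\log T}\ \ge\ c'\cdot\mathrm{dec}^c_{\varepsilon_T}(\mathcal M)\cdot\frac{T}{\log T}-C'\cdot\frac{\sqrt T}{\log T}.$$ -/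

import Mathlib

open MeasureTheory ProbabilityTheory
open scoped ENNReal NNReal

namespace DMSO

noncomputable section

/-- Squared Hellinger distance `∫ (√(dP/dν) - √(dQ/dν))² dν`, computed with the common dominating
measure `ν = P + Q`. -/
def hellingerSq {X : Type*} [MeasurableSpace X] (P Q : Measure X) : ℝ≥0∞ :=
  ∫⁻ x, ENNReal.ofReal
    ((√(P.rnDeriv (P + Q) x).toReal - √(Q.rnDeriv (P + Q) x).toReal) ^ 2) ∂(P + Q)

/-- A model with decision space `D`, reward space `[0, 1]` and observation space `O`: a probability
kernel sending a decision to the joint law of the reward and the observation. The type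
`Model D O` is the space of all models with rewards in `[0, 1]`. -/
structure Model (D O : Type*) [MeasurableSpace D] [MeasurableSpace O] where
  kernel : Kernel D (unitInterval × O)
  isMarkovKernel : IsMarkovKernel kernel

/-- One round of interaction: the decision together with the reward and the observation. -/
abbrev Round (D O : Type*) : Type _ := D × (unitInterval × O)

/-- A (randomized, adaptive) algorithm: after `t` completed rounds, the next decision is drawn from
a probability kernel applied to the history of these `t` rounds. Within a horizon `T` only the
kernels with `t < T` are used. -/
structure Algorithm (D O : Type*) [MeasurableSpace D] [MeasurableSpace O] where
  policy : (t : ℕ) → Kernel (Fin t → Round D O) D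
  isMarkovKernel : ∀ t, IsMarkovKernel (policy t)

attribute [instance] Model.isMarkovKernel Algorithm.isMarkovKernel

section

variable {D O : Type*} [MeasurableSpace D] [MeasurableSpace O]

/-- Mean reward of the decision `x` under the model `M`. -/
def Model.meanReward (M : Model D O) (x : D) : ℝ :=
  ∫ y, (y.1 : ℝ) ∂(M.kernel x)

/-- Suboptimality of the decision `x` under `M`: the optimal mean reward minus the mean reward of
`x`. The optimal value is written as a supremum, which is the value at a maximizer whenever a
maximizer exists. -/
def Model.gap (M : Model D O) (x : D) : ℝ :=
  (⨆ x' : D, M.meanReward x') - M.meanReward x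

/-- Expected squared Hellinger distance between `M` and `N` when the decision is drawn from `p`. The
integrand is nonnegative; should it fail to be measurable (which cannot happen when the σ-algebra
of `O` is countably generated), this is its lower integral. -/
def expHellingerSq (p : ProbabilityMeasure D) (M N : Model D O) : ℝ≥0∞ :=
  ∫⁻ x, hellingerSq (M.kernel x) (N.kernel x) ∂(p : Measure D)

/-- Constrained regret decision-estimation coefficient of the class `𝓜` at radius `ε` relative to
the reference model `N`. The supremum of the empty set of reals is `0`, so a distribution `p` for
which no model of `𝓜` meets the constraint contributes the value `0`. -/
def decRegAt (ε : ℝ) (𝓜 : Set (Model D O)) (N : Model D O) : ℝ :=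
  ⨅ p : ProbabilityMeasure D,
    ⨆ M : {M : Model D O // M ∈ 𝓜 ∧ expHellingerSq p M N ≤ ENNReal.ofReal (ε ^ 2)},
      ∫ x, M.1.gap x ∂(p : Measure D)

/-- The convex hull of a class of models, mixtures being taken decision by decision. -/
def co (𝓜 : Set (Model D O)) : Set (Model D O) :=
  {N | (fun x ↦ N.kernel x) ∈
    convexHull ℝ≥0 ((fun (M : Model D O) (x : D) ↦ M.kernel x) '' 𝓜)}

/-- Constrained regret decision-estimation coefficient of the class `𝓜` at radius `ε`. -/
def decReg (ε : ℝ) (𝓜 : Set (Model D O)) : ℝ :=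
  ⨆ N : {N : Model D O // N ∈ co 𝓜}, decRegAt ε (𝓜 ∪ {N.1}) N.1

/-- The variant of `decReg` in which the reference model ranges over all models. -/
def decRegAll (ε : ℝ) (𝓜 : Set (Model D O)) : ℝ :=
  ⨆ N : Model D O, decRegAt ε (𝓜 ∪ {N}) N

/-- Largest likelihood ratio between two models of the class, and at least `e`. Here `a / 0 = ∞`
for `a ≠ 0`, and `0 / 0 = 0`. -/
def ratioBound (𝓜 : Set (Model D O)) : ℝ≥0∞ :=
  (⨆ M ∈ 𝓜, ⨆ M' ∈ 𝓜, ⨆ x : D, ⨆ A : {A : Set (unitInterval × O) // MeasurableSet A},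
    M.kernel x A.1 / M'.kernel x A.1) ⊔ ENNReal.ofReal (Real.exp 1)

/-- The quantity `log (T ∧ V(𝓜))`. -/
def logFactor (T : ℕ) (𝓜 : Set (Model D O)) : ℝ :=
  Real.log (min (T : ℝ≥0∞) (ratioBound 𝓜)).toReal

/-- Law of the next round given the history of the first `t` rounds. -/
def roundKernel (M : Model D O) (a : Algorithm D O) (t : ℕ) :
    Kernel (Fin t → Round D O) (Round D O) :=
  (a.policy t).compProd (M.kernel.prodMkLeft (Fin t → Round D O))

/-- Law of the history of the first `t` rounds when the algorithm `a` interacts with `M`. -/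
def historyLaw (M : Model D O) (a : Algorithm D O) : (t : ℕ) → Measure (Fin t → Round D O)
  | 0 => Measure.dirac Fin.elim0
  | t + 1 => ((historyLaw M a t).compProd (roundKernel M a t)).map
      (fun h ↦ (Fin.snoc h.1 h.2 : Fin (t + 1) → Round D O))

/-- Appending a round to a history is measurable, so the push-forward above is the intended one. -/
theorem measurable_snoc (t : ℕ) :
    Measurable (fun h : (Fin t → Round D O) × Round D O ↦
      (Fin.snoc h.1 h.2 : Fin (t + 1) → Round D O)) := by
  refine measurable_pi_lambda _ fun i ↦ ?_
  induction i using Fin.lastCases with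
  | last => simpa using measurable_snd
  | cast i =>
    simp only [Fin.snoc_castSucc]
    exact (measurable_pi_apply i).comp measurable_fst

/-- Cumulative regret over `T` rounds as a function of the history: the sum over the rounds of the
conditional expectation of the suboptimality of the decision given the past. -/
def regret (M : Model D O) (a : Algorithm D O) (T : ℕ) (h : Fin T → Round D O) : ℝ :=
  ∑ t : Fin T, ∫ x, M.gap x ∂(a.policy t (fun i ↦ h (Fin.castLE t.isLt.le i)))

/-- Expected cumulative regret over `T` rounds of the algorithm `a` under the model `M`. -/
def expectedRegret (M : Model D O) (a : Algorithm D O) (T : ℕ) : ℝ :=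
  ∫ h, regret M a T h ∂(historyLaw M a T)

end

end

end DMSO

/-! Fix an algorithm and a reference model N that nearly attains `decRegAll`, and write Δ for its
coefficient. Modify the algorithm: once its cumulative N-gap exceeds B = ΔT/4, it plays a decision
that is nearly optimal for N. Under N the modified algorithm then has total gap at most 3ΔT/8.
Feeding its average decision law into the definition of the coefficient yields M, with small average
Hellinger distance to N, whose average gap exceeds 7Δ/8. This M cannot be N, so it lies in the
class. Since mean rewards of M and N are close on average, the optimal values must differ by at
least Δ/4.

Consequently every round costs either N-gap or M-gap: up to an error of small expectation, the M-gap
accumulated before stopping is at least B. This holds under N because either the N-gap budget B was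
spent, or no stop occurred and all T rounds paid Δ/4 (`le_stoppedSum_add_sum`). It transfers to M by
a change of measure, and the M-gap before stopping is the same in law for the original algorithm
(`lintegral_stoppedSum_stopAt`). Stopping is what lets an arbitrary algorithm be treated as having
small regret under N.

The change of measure (`abs_integral_historyLaw_sub_le`) uses only the Hellinger information
gathered under N, with no bound on likelihood ratios. Under the midpoint of M and N, a suitable
`potential` is a submartingale whose increments are perfect squares (`le_integral_potential`). It
gives squared Hellinger distance at most 1/l + lδ between history laws when the information is at
most δ, so Tε² below an absolute constant suffices. The resulting regret bound ΔT/16 has no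
logarithmic loss; the stated form follows from log 2 ≤ log(T ∧ V) ≤ T and log T ≥ log 2.

Outcome spaces are arbitrary, so kernels need not have jointly measurable densities in the usual
sense. Densities are taken only almost everywhere event by event, and are compared with the true
Hellinger distance through its variational formula. -/

namespace DMSO

/-! ### Weak joint densities of kernels. -/

section KernelDensity

variable {D Y Z : Type*} [MeasurableSpace D] [MeasurableSpace Y] [MeasurableSpace Z]

/-- `h` is a jointly measurable density of the kernel `M` with respect to the kernel `R`, bounded by
`2`, in the weak sense that for each event the defining identity holds `μ`-almost everywhere. -/
structure IsKernelDensity (μ : Measure D) (M R : Kernel D Y) (h : D × Y → ℝ) : Prop where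
  measurable : Measurable h
  nonneg : ∀ z, 0 ≤ h z
  le_two : ∀ z, h z ≤ 2
  setLIntegral : ∀ s, MeasurableSet s →
    ∀ᵐ x ∂μ, M x s = ∫⁻ y in s, ENNReal.ofReal (h (x, y)) ∂(R x)

/-- Radon–Nikodym is applied to the joint laws on `D × Y`, which makes the density jointly
measurable. The price is an exceptional null set of decisions that depends on the event. -/
theorem exists_isKernelDensity (μ : Measure D) [IsFiniteMeasure μ] (M R : Kernel D Y)
    [IsMarkovKernel M] [IsMarkovKernel R] (hMR : ∀ x, M x ≤ (2 : ℝ≥0∞) • R x) :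
    ∃ h, IsKernelDensity μ M R h := by
  have hle : ∀ s, MeasurableSet s → (μ ⊗ₘ M) s ≤ 2 * (μ ⊗ₘ R) s := by
    intro s hs
    rw [Measure.compProd_apply hs, Measure.compProd_apply hs,
      ← lintegral_const_mul _ (Kernel.measurable_kernel_prodMk_left hs)]
    exact lintegral_mono fun x ↦ hMR x _
  have hac : μ ⊗ₘ M ≪ μ ⊗ₘ R := by
    refine Measure.AbsolutelyContinuous.mk fun s hs h0 ↦ ?_
    have := hle s hs
    rw [h0, mul_zero] at this
    exact le_antisymm this zero_le
  set g := (μ ⊗ₘ M).rnDeriv (μ ⊗ₘ R) with hg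
  have hgm : Measurable g := Measure.measurable_rnDeriv _ _
  have hwd : (μ ⊗ₘ R).withDensity g = μ ⊗ₘ M := Measure.withDensity_rnDeriv_eq _ _ hac
  have hg2 : g ≤ᵐ[μ ⊗ₘ R] fun _ ↦ 2 := by
    refine ae_le_of_forall_setLIntegral_le_of_sigmaFinite hgm fun s hs _ ↦ ?_
    rw [← withDensity_apply _ hs, hwd]
    simpa using hle s hs
  have heq : (fun z ↦ ENNReal.ofReal (min (g z) 2).toReal) =ᵐ[μ ⊗ₘ R] g := by
    filter_upwards [hg2] with z hz
    rw [min_eq_left hz, ENNReal.ofReal_toReal (ne_top_of_le_ne_top (by simp) hz)]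
  -- Truncating at 2 changes nothing almost everywhere and makes the bound hold at every point.
  refine ⟨fun z ↦ (min (g z) 2).toReal, (hgm.min measurable_const).ennreal_toReal,
    fun z ↦ ENNReal.toReal_nonneg, fun z ↦ ?_, fun s hs ↦ ?_⟩
  · have : (min (g z) 2).toReal ≤ (2 : ℝ≥0∞).toReal :=
      ENNReal.toReal_mono (by simp) (min_le_right _ _)
    simpa using this
  · have hm : Measurable fun z : D × Y ↦ ENNReal.ofReal (min (g z) 2).toReal :=
      (hgm.min measurable_const).ennreal_toReal.ennreal_ofReal
    have hms : Measurable fun x ↦ ∫⁻ y in s, ENNReal.ofReal (min (g (x, y)) 2).toReal ∂(R x) := by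
      have : ∀ x, ∫⁻ y in s, ENNReal.ofReal (min (g (x, y)) 2).toReal ∂(R x)
          = ∫⁻ y, ENNReal.ofReal (min (g (x, y)) 2).toReal ∂(R.restrict hs x) := by
        intro x; rw [Kernel.restrict_apply]
      simp_rw [this]
      exact hm.lintegral_kernel_prod_right'
    refine ae_eq_of_forall_setLIntegral_eq_of_sigmaFinite (M.measurable_coe hs) hms
      fun t ht _ ↦ ?_
    have h1 : ∫⁻ x in t, M x s ∂μ = (μ ⊗ₘ M) (t ×ˢ s) := by
      rw [Measure.compProd_apply_prod ht hs]
    have h2 : (μ ⊗ₘ M) (t ×ˢ s)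
        = ∫⁻ z in t ×ˢ s, ENNReal.ofReal (min (g z) 2).toReal ∂(μ ⊗ₘ R) := by
      rw [← hwd, withDensity_apply _ (ht.prod hs)]
      exact lintegral_congr_ae (ae_restrict_of_ae heq.symm)
    rw [h1, h2, Measure.setLIntegral_compProd hm ht hs]

namespace IsKernelDensity

variable {μ : Measure D} {M R : Kernel D Y} [IsMarkovKernel M] [IsMarkovKernel R]
  {h : D × Y → ℝ}

/-- Event-dependent null sets are harmless after integration: measures on a product are determined
by rectangles, and each rectangle involves one event of `Y`. Here `Z` will be a history together
with the next decision. -/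
theorem compProd_comap (H : IsKernelDensity μ M R h) {q : Measure Z}
    [IsFiniteMeasure q] {f : Z → D} (hf : Measurable f) (hq : q.map f ≪ μ) :
    q ⊗ₘ (M.comap f hf) = (q ⊗ₘ (R.comap f hf)).withDensity
      (fun z ↦ ENNReal.ofReal (h (f z.1, z.2))) := by
  have hm : Measurable fun z : Z × Y ↦ ENNReal.ofReal (h (f z.1, z.2)) :=
    (H.measurable.comp (by fun_prop)).ennreal_ofReal
  refine Measure.ext_prod fun {s t} hs ht ↦ ?_
  rw [Measure.compProd_apply_prod hs ht, withDensity_apply _ (hs.prod ht),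
    Measure.setLIntegral_compProd hm hs ht]
  refine lintegral_congr_ae (ae_restrict_of_ae ?_)
  exact ae_of_ae_map hf.aemeasurable (hq.ae_le (H.setLIntegral t ht))

theorem lintegral_comap (H : IsKernelDensity μ M R h) {q : Measure Z}
    [IsFiniteMeasure q] {f : Z → D} (hf : Measurable f) (hq : q.map f ≪ μ)
    {G : Z × Y → ℝ≥0∞} (hG : Measurable G) :
    ∫⁻ z, ∫⁻ y, G (z, y) ∂(M (f z)) ∂q
      = ∫⁻ z, ∫⁻ y, ENNReal.ofReal (h (f z, y)) * G (z, y) ∂(R (f z)) ∂q := by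
  have hm : Measurable fun z : Z × Y ↦ ENNReal.ofReal (h (f z.1, z.2)) :=
    (H.measurable.comp (by fun_prop)).ennreal_ofReal
  have h1 := Measure.lintegral_compProd (μ := q) (κ := M.comap f hf) hG
  rw [H.compProd_comap hf hq, lintegral_withDensity_eq_lintegral_mul _ hm hG,
    Measure.lintegral_compProd (hm.mul hG)] at h1
  simpa using h1.symm

theorem ae_lintegral_eq [IsFiniteMeasure μ] (H : IsKernelDensity μ M R h)
    {G : D × Y → ℝ≥0∞} (hG : Measurable G) :
    ∀ᵐ x ∂μ, ∫⁻ y, G (x, y) ∂(M x) = ∫⁻ y, ENNReal.ofReal (h (x, y)) * G (x, y) ∂(R x) := by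
  refine ae_eq_of_forall_setLIntegral_eq_of_sigmaFinite hG.lintegral_kernel_prod_right'
    (H.measurable.ennreal_ofReal.mul hG).lintegral_kernel_prod_right' fun s hs _ ↦ ?_
  refine H.lintegral_comap (q := μ.restrict s) measurable_id ?_ hG
  rw [Measure.map_id]
  exact Measure.restrict_le_self.absolutelyContinuous

theorem ae_integral_eq [IsFiniteMeasure μ] (H : IsKernelDensity μ M R h)
    {G : D × Y → ℝ} (hG : Measurable G) (hG0 : ∀ z, 0 ≤ G z) :
    ∀ᵐ x ∂μ, ∫ y, G (x, y) ∂(M x) = ∫ y, h (x, y) * G (x, y) ∂(R x) := by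
  filter_upwards [H.ae_lintegral_eq hG.ennreal_ofReal] with x hx
  have hh := H.measurable
  rw [integral_eq_lintegral_of_nonneg_ae (.of_forall fun y ↦ hG0 _)
      (hG.comp measurable_prodMk_left).aestronglyMeasurable, integral_eq_lintegral_of_nonneg_ae
        (.of_forall fun y ↦ mul_nonneg (H.nonneg _) (hG0 _))
        ((hh.mul hG).comp measurable_prodMk_left).aestronglyMeasurable, hx]
  simp_rw [ENNReal.ofReal_mul (H.nonneg _)]

end IsKernelDensity

end KernelDensity

/-! ### Hellinger distance: comparison of integrals and variational formula. -/

section Hellinger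

variable {Y : Type*} [MeasurableSpace Y]

/-- Factor a - b = (√a - √b)(√a + √b) and apply the weighted AM-GM inequality; this replaces
Cauchy–Schwarz after integration, with l left free. -/
theorem abs_sub_le_of_sqrt {a b l : ℝ} (ha : 0 ≤ a) (hb : 0 ≤ b) (hl : 0 < l) :
    |a - b| ≤ l / 2 * (√a - √b) ^ 2 + 1 / l * (a + b) := by
  obtain ⟨u, hu, rfl⟩ : ∃ u, 0 ≤ u ∧ u ^ 2 = a := ⟨√a, Real.sqrt_nonneg _, Real.sq_sqrt ha⟩
  obtain ⟨v, hv, rfl⟩ : ∃ v, 0 ≤ v ∧ v ^ 2 = b := ⟨√b, Real.sqrt_nonneg _, Real.sq_sqrt hb⟩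
  rw [Real.sqrt_sq hu, Real.sqrt_sq hv]
  have h1 : |u ^ 2 - v ^ 2| = |u - v| * (u + v) := by
    rw [sq_sub_sq, abs_mul, abs_of_nonneg (add_nonneg hu hv)]; ring
  have h2 : 0 ≤ (l * |u - v| - (u + v)) ^ 2 / (2 * l) := by positivity
  have h3 : (l * |u - v| - (u + v)) ^ 2 / (2 * l)
      = l / 2 * (u - v) ^ 2 + (u + v) ^ 2 / (2 * l) - |u - v| * (u + v) := by
    rw [← sq_abs (u - v)]; field_simp; ring
  have h4 : (u + v) ^ 2 / (2 * l) ≤ 1 / l * (u ^ 2 + v ^ 2) := by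
    rw [div_mul_eq_mul_div, div_le_div_iff₀ (by positivity) hl]
    nlinarith [sq_nonneg (u - v), mul_nonneg hl.le (sq_nonneg (u - v))]
  rw [h1]; linarith

theorem sqrt_sub_sqrt_sq {a b : ℝ} (ha : 0 ≤ a) (hb : 0 ≤ b) :
    (√a - √b) ^ 2 = a + b - 2 * √(a * b) := by
  rw [Real.sqrt_mul ha]
  nlinarith [Real.sq_sqrt ha, Real.sq_sqrt hb]

/-- Integrals of a bounded function against two densities differ by at most a multiple of the
squared distance of the square roots of the densities, plus a small constant. -/
theorem abs_integral_density_sub_le {μ : Measure Y} {p q F : Y → ℝ} (hp : Integrable p μ)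
    (hq : Integrable q μ) (hp0 : ∀ y, 0 ≤ p y) (hq0 : ∀ y, 0 ≤ q y)
    (hsq : Integrable (fun y ↦ (√(p y) - √(q y)) ^ 2) μ)
    (hp1 : ∫ y, p y ∂μ = 1) (hq1 : ∫ y, q y ∂μ = 1)
    (hF : Measurable F) (hF1 : ∀ y, |F y| ≤ 1) {l : ℝ} (hl : 0 < l) :
    |∫ y, p y * F y ∂μ - ∫ y, q y * F y ∂μ|
      ≤ l / 2 * ∫ y, (√(p y) - √(q y)) ^ 2 ∂μ + 2 / l := by
  have hpF : Integrable (fun y ↦ p y * F y) μ :=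
    hp.mul_bdd (c := 1) hF.aestronglyMeasurable (.of_forall hF1)
  have hqF : Integrable (fun y ↦ q y * F y) μ :=
    hq.mul_bdd (c := 1) hF.aestronglyMeasurable (.of_forall hF1)
  have hpq : Integrable (fun y ↦ p y + q y) μ := hp.add hq
  rw [← integral_sub hpF hqF]
  calc |∫ y, (p y * F y - q y * F y) ∂μ|
      ≤ ∫ y, |p y * F y - q y * F y| ∂μ := abs_integral_le_integral_abs
    _ ≤ ∫ y, (l / 2 * (√(p y) - √(q y)) ^ 2 + 1 / l * (p y + q y)) ∂μ := by
        refine integral_mono (hpF.sub hqF).abs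
          ((hsq.const_mul _).add (hpq.const_mul _)) fun y ↦ ?_
        dsimp only
        rw [← sub_mul, abs_mul]
        calc |p y - q y| * |F y| ≤ |p y - q y| * 1 :=
              mul_le_mul_of_nonneg_left (hF1 y) (abs_nonneg _)
          _ ≤ _ := by rw [mul_one]; exact abs_sub_le_of_sqrt (hp0 y) (hq0 y) hl
    _ = _ := by
        rw [integral_add (hsq.const_mul _) (hpq.const_mul _), integral_const_mul,
          integral_const_mul, integral_add hp hq, hp1, hq1]
        ring

theorem absolutelyContinuous_add_left (P Q : Measure Y) : P ≪ P + Q :=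
  (Measure.le_add_right le_rfl).absolutelyContinuous

theorem absolutelyContinuous_add_right (P Q : Measure Y) : Q ≪ P + Q :=
  (Measure.le_add_left le_rfl).absolutelyContinuous

variable (P Q : Measure Y) [IsProbabilityMeasure P] [IsProbabilityMeasure Q]

theorem integrable_sqrt_sub_sqrt_sq {μ : Measure Y} {p q : Y → ℝ} (hp : Integrable p μ)
    (hq : Integrable q μ) (hpm : Measurable p) (hqm : Measurable q)
    (hp0 : ∀ y, 0 ≤ p y) (hq0 : ∀ y, 0 ≤ q y) :
    Integrable (fun y ↦ (√(p y) - √(q y)) ^ 2) μ := by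
  refine (hp.add hq).mono'
    ((hpm.sqrt.sub hqm.sqrt).pow_const 2).aestronglyMeasurable (.of_forall fun y ↦ ?_)
  rw [Real.norm_eq_abs, abs_of_nonneg (sq_nonneg _), sqrt_sub_sqrt_sq (hp0 y) (hq0 y)]
  simp only [Pi.add_apply]
  linarith [Real.sqrt_nonneg (p y * q y)]

theorem hellingerSq_eq_ofReal : hellingerSq P Q = ENNReal.ofReal
    (∫ y, (√(P.rnDeriv (P + Q) y).toReal - √(Q.rnDeriv (P + Q) y).toReal) ^ 2 ∂(P + Q)) := by
  rw [hellingerSq, ofReal_integral_eq_lintegral_ofReal]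
  · exact integrable_sqrt_sub_sqrt_sq Measure.integrable_toReal_rnDeriv
      Measure.integrable_toReal_rnDeriv (Measure.measurable_rnDeriv _ _).ennreal_toReal
      (Measure.measurable_rnDeriv _ _).ennreal_toReal (fun _ ↦ ENNReal.toReal_nonneg)
      (fun _ ↦ ENNReal.toReal_nonneg)
  · exact .of_forall fun _ ↦ sq_nonneg _

theorem ofReal_abs_integral_sub_le_hellingerSq {F : Y → ℝ} (hF : Measurable F)
    (hF1 : ∀ y, |F y| ≤ 1) {l : ℝ} (hl : 0 < l) :
    ENNReal.ofReal |∫ y, F y ∂P - ∫ y, F y ∂Q|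
      ≤ ENNReal.ofReal (l / 2) * hellingerSq P Q + ENNReal.ofReal (2 / l) := by
  have hP := absolutelyContinuous_add_left P Q
  have hQ := absolutelyContinuous_add_right P Q
  have h1 := integral_rnDeriv_smul (f := F) hP
  have h2 := integral_rnDeriv_smul (f := F) hQ
  have hp1 : ∫ y, (P.rnDeriv (P + Q) y).toReal ∂(P + Q) = 1 := by
    rw [Measure.integral_toReal_rnDeriv hP]; simp
  have hq1 : ∫ y, (Q.rnDeriv (P + Q) y).toReal ∂(P + Q) = 1 := by
    rw [Measure.integral_toReal_rnDeriv hQ]; simp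
  have hpm := (Measure.measurable_rnDeriv P (P + Q)).ennreal_toReal
  have hqm := (Measure.measurable_rnDeriv Q (P + Q)).ennreal_toReal
  have hpi : Integrable (fun y ↦ (P.rnDeriv (P + Q) y).toReal) (P + Q) :=
    Measure.integrable_toReal_rnDeriv
  have hqi : Integrable (fun y ↦ (Q.rnDeriv (P + Q) y).toReal) (P + Q) :=
    Measure.integrable_toReal_rnDeriv
  have := abs_integral_density_sub_le (F := F) hpi hqi
    (fun _ ↦ ENNReal.toReal_nonneg) (fun _ ↦ ENNReal.toReal_nonneg)
    (integrable_sqrt_sub_sqrt_sq hpi hqi hpm hqm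
      (fun _ ↦ ENNReal.toReal_nonneg) (fun _ ↦ ENNReal.toReal_nonneg))
    hp1 hq1 hF hF1 hl
  simp only [smul_eq_mul] at h1 h2
  rw [h1, h2] at this
  rw [hellingerSq_eq_ofReal, ← ENNReal.ofReal_mul (by positivity),
    ← ENNReal.ofReal_add (mul_nonneg (by positivity) (integral_nonneg fun _ ↦ sq_nonneg _))
      (by positivity)]
  exact ENNReal.ofReal_le_ofReal this

/-- Variational lower bound for the squared Hellinger distance. -/
theorem ofReal_variational_le_hellingerSq {F : Y → ℝ} (hF : Measurable F) {b : ℝ}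
    (hF0 : ∀ y, 0 < F y) (hFb : ∀ y, F y ≤ b) (hFb' : ∀ y, (F y)⁻¹ ≤ b) :
    ENNReal.ofReal (2 - ∫ y, F y ∂P - ∫ y, (F y)⁻¹ ∂Q) ≤ hellingerSq P Q := by
  have hP := absolutelyContinuous_add_left P Q
  have hQ := absolutelyContinuous_add_right P Q
  have h1 := integral_rnDeriv_smul (f := F) hP
  have h2 := integral_rnDeriv_smul (f := fun y ↦ (F y)⁻¹) hQ
  have hp1 : ∫ y, (P.rnDeriv (P + Q) y).toReal ∂(P + Q) = 1 := by
    rw [Measure.integral_toReal_rnDeriv hP]; simp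
  have hq1 : ∫ y, (Q.rnDeriv (P + Q) y).toReal ∂(P + Q) = 1 := by
    rw [Measure.integral_toReal_rnDeriv hQ]; simp
  have hpm := (Measure.measurable_rnDeriv P (P + Q)).ennreal_toReal
  have hqm := (Measure.measurable_rnDeriv Q (P + Q)).ennreal_toReal
  have hpi : Integrable (fun y ↦ (P.rnDeriv (P + Q) y).toReal) (P + Q) :=
    Measure.integrable_toReal_rnDeriv
  have hqi : Integrable (fun y ↦ (Q.rnDeriv (P + Q) y).toReal) (P + Q) :=
    Measure.integrable_toReal_rnDeriv
  rw [hellingerSq_eq_ofReal]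
  refine ENNReal.ofReal_le_ofReal ?_
  set p := fun y ↦ (P.rnDeriv (P + Q) y).toReal with hpdef
  set q := fun y ↦ (Q.rnDeriv (P + Q) y).toReal with hqdef
  have hp0 : ∀ y, 0 ≤ p y := fun _ ↦ ENNReal.toReal_nonneg
  have hq0 : ∀ y, 0 ≤ q y := fun _ ↦ ENNReal.toReal_nonneg
  have hpF : Integrable (fun y ↦ p y * F y) (P + Q) :=
    hpi.mul_bdd (c := b) hF.aestronglyMeasurable
      (.of_forall fun y ↦ by rw [Real.norm_eq_abs, abs_of_pos (hF0 y)]; exact hFb y)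
  have hqF : Integrable (fun y ↦ q y * (F y)⁻¹) (P + Q) :=
    hqi.mul_bdd (c := b) hF.inv.aestronglyMeasurable
      (.of_forall fun y ↦ by
        rw [Real.norm_eq_abs, abs_of_pos (inv_pos.2 (hF0 y))]; exact hFb' y)
  simp only [smul_eq_mul] at h1 h2
  have h3 : 2 - ∫ y, F y ∂P - ∫ y, (F y)⁻¹ ∂Q
      = ∫ y, (p y + q y - p y * F y - q y * (F y)⁻¹) ∂(P + Q) := by
    rw [integral_sub (by fun_prop) hqF, integral_sub (by fun_prop) hpF, integral_add hpi hqi,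
      hp1, hq1, ← h1, ← h2]
    norm_num
    rfl
  rw [h3]
  refine integral_mono (by fun_prop)
    (integrable_sqrt_sub_sqrt_sq hpi hqi hpm hqm hp0 hq0) fun y ↦ ?_
  change p y + q y - p y * F y - q y * (F y)⁻¹ ≤ (√(p y) - √(q y)) ^ 2
  rw [sqrt_sub_sqrt_sq (hp0 y) (hq0 y)]
  -- The claim is pointwise: by AM-GM, twice √(pq) is at most pF + q/F.
  have h4 : √(p y * q y) = √(p y * F y) * √(q y * (F y)⁻¹) := by
    rw [← Real.sqrt_mul (mul_nonneg (hp0 y) (hF0 y).le)]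
    congr 1
    have := (hF0 y).ne'
    field_simp
  have h5 := Real.sq_sqrt (mul_nonneg (hp0 y) (hF0 y).le)
  have h6 := Real.sq_sqrt (mul_nonneg (hq0 y) (inv_nonneg.2 (hF0 y).le))
  rw [h4]
  nlinarith [sq_nonneg (√(p y * F y) - √(q y * (F y)⁻¹))]

end Hellinger

/-! ### Hellinger distance of kernels through weak densities. -/

section KernelHellinger

variable {D Y : Type*} [MeasurableSpace D] [MeasurableSpace Y]

theorem sqrt_ratio_bound {h k η : ℝ} (hh : 0 ≤ h) (hk : 0 ≤ k) (hη : 0 ≤ η) :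
    h * √((k + η ^ 2) / (h + η ^ 2)) ≤ √(h * k) + η * √h := by
  rcases hh.eq_or_lt with rfl | hh
  · simp
  have h1 : √((k + η ^ 2) / (h + η ^ 2)) ≤ (√k + η) / √h := by
    rw [Real.sqrt_div (by positivity)]
    have h2 : √(k + η ^ 2) ≤ √k + η := by
      rw [Real.sqrt_le_left (by positivity)]
      nlinarith [Real.sq_sqrt hk, Real.sqrt_nonneg k, mul_nonneg (Real.sqrt_nonneg k) hη]
    have h3 : √h ≤ √(h + η ^ 2) := Real.sqrt_le_sqrt (by nlinarith)
    have : 0 < √h := Real.sqrt_pos.2 hh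
    gcongr
  calc h * √((k + η ^ 2) / (h + η ^ 2)) ≤ h * ((√k + η) / √h) := by gcongr
    _ = √h * (√k + η) := by
        have : 0 < √h := Real.sqrt_pos.2 hh
        nth_rw 1 [← Real.mul_self_sqrt hh.le]
        field_simp
    _ = _ := by rw [Real.sqrt_mul hh.le]; ring

/-- The Hellinger distance of the weak densities is at most the Hellinger distance of the kernels,
almost everywhere. -/
theorem IsKernelDensity.ae_le_hellingerSq {μ : Measure D} [IsFiniteMeasure μ]
    {M N R : Kernel D Y} [IsMarkovKernel M] [IsMarkovKernel N] [IsMarkovKernel R]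
    {h k : D × Y → ℝ} (H : IsKernelDensity μ M R h) (K : IsKernelDensity μ N R k) :
    ∀ᵐ x ∂μ, ENNReal.ofReal (2 - 2 * ∫ y, √(h (x, y) * k (x, y)) ∂(R x))
      ≤ hellingerSq (M x) (N x) := by
  have hhm := H.measurable
  have hkm := K.measurable
  have key : ∀ n : ℕ, ∀ᵐ x ∂μ, ENNReal.ofReal
      (2 - 2 * ∫ y, √(h (x, y) * k (x, y)) ∂(R x) - 4 * (1 / ((n : ℝ) + 1)))
        ≤ hellingerSq (M x) (N x) := by
    intro n
    -- The optimal test function is √(k/h). Adding η² to both densities keeps it and its inverse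
    -- bounded and costs at most 2η in each of the two integrals. As F is one jointly measurable
    -- function, the weak density identity holds for it almost everywhere.
    set η : ℝ := 1 / ((n : ℝ) + 1) with hη
    have hη0 : 0 < η := by positivity
    let F : D × Y → ℝ := fun z ↦ √((k z + η ^ 2) / (h z + η ^ 2))
    have hFm : Measurable F := by fun_prop
    have hF0 : ∀ z, 0 < F z := fun z ↦ Real.sqrt_pos.2 <|
      div_pos (by nlinarith [K.nonneg z, sq_pos_of_pos hη0])
        (by nlinarith [H.nonneg z, sq_pos_of_pos hη0])
    have hFinv : ∀ z, (F z)⁻¹ = √((h z + η ^ 2) / (k z + η ^ 2)) := fun z ↦ by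
      rw [← Real.sqrt_inv, inv_div]
    have hb : ∀ u v : ℝ, 0 ≤ u → 0 ≤ v → u ≤ 2 → √((u + η ^ 2) / (v + η ^ 2))
        ≤ √((2 + η ^ 2) / η ^ 2) := by
      intro u v hu hv hu2
      refine Real.sqrt_le_sqrt ?_
      have : 0 < η ^ 2 := by positivity
      gcongr
      linarith
    filter_upwards [H.ae_integral_eq hFm fun z ↦ (hF0 z).le,
      K.ae_integral_eq hFm.inv fun z ↦ (inv_pos.2 (hF0 z)).le] with x hx1 hx2
    refine le_trans (ENNReal.ofReal_le_ofReal ?_)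
      (ofReal_variational_le_hellingerSq (M x) (N x) (F := fun y ↦ F (x, y))
        (hFm.comp measurable_prodMk_left) (b := √((2 + η ^ 2) / η ^ 2)) (fun y ↦ hF0 _)
        (fun y ↦ hb _ _ (K.nonneg _) (H.nonneg _) (K.le_two _))
        (fun y ↦ by rw [hFinv]; exact hb _ _ (H.nonneg _) (K.nonneg _) (H.le_two _)))
    simp only [Pi.inv_apply] at hx2
    rw [hx1, hx2]
    have hsm : Measurable fun y ↦ √(h (x, y) * k (x, y)) := by fun_prop
    have hsi : Integrable (fun y ↦ √(h (x, y) * k (x, y))) (R x) := by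
      refine Integrable.of_bound hsm.aestronglyMeasurable 2 (.of_forall fun y ↦ ?_)
      rw [Real.norm_eq_abs, abs_of_nonneg (Real.sqrt_nonneg _), Real.sqrt_le_left (by norm_num)]
      nlinarith [H.nonneg (x, y), H.le_two (x, y), K.nonneg (x, y), K.le_two (x, y)]
    have hs2 : ∀ u : ℝ, u ≤ 2 → √u ≤ 2 := fun u hu ↦ by
      rw [Real.sqrt_le_left (by norm_num)]; linarith
    have hA : ∫ y, h (x, y) * F (x, y) ∂(R x)
        ≤ ∫ y, (√(h (x, y) * k (x, y)) + η * 2) ∂(R x) := by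
      refine integral_mono_of_nonneg (.of_forall fun y ↦ mul_nonneg (H.nonneg _) (hF0 _).le)
        (hsi.add (integrable_const _)) (.of_forall fun y ↦ ?_)
      dsimp only
      refine (sqrt_ratio_bound (H.nonneg _) (K.nonneg _) hη0.le).trans ?_
      gcongr
      exact hs2 _ (H.le_two _)
    have hB : ∫ y, k (x, y) * (F (x, y))⁻¹ ∂(R x)
        ≤ ∫ y, (√(h (x, y) * k (x, y)) + η * 2) ∂(R x) := by
      refine integral_mono_of_nonneg
        (.of_forall fun y ↦ mul_nonneg (K.nonneg _) (inv_pos.2 (hF0 _)).le)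
        (hsi.add (integrable_const _)) (.of_forall fun y ↦ ?_)
      dsimp only
      rw [hFinv]
      refine (sqrt_ratio_bound (K.nonneg _) (H.nonneg _) hη0.le).trans ?_
      rw [mul_comm (k (x, y))]
      gcongr
      exact hs2 _ (K.le_two _)
    rw [integral_add hsi (integrable_const _)] at hA hB
    simp only [integral_const, probReal_univ, one_smul] at hA hB
    linarith
  -- Only countably many values of η are used, so one null set serves all of them and η can tend to
  -- 0.
  filter_upwards [ae_all_iff.2 key] with x hx
  have ht : Filter.Tendsto (fun n : ℕ ↦ ENNReal.ofReal
      (2 - 2 * ∫ y, √(h (x, y) * k (x, y)) ∂(R x) - 4 * (1 / ((n : ℝ) + 1)))) Filter.atTop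
      (nhds (ENNReal.ofReal (2 - 2 * ∫ y, √(h (x, y) * k (x, y)) ∂(R x) - 4 * 0))) :=
    ENNReal.tendsto_ofReal
      ((tendsto_one_div_add_atTop_nhds_zero_nat (𝕜 := ℝ)).const_mul 4 |>.const_sub _)
  rw [mul_zero, sub_zero] at ht
  exact le_of_tendsto' ht hx

end KernelHellinger

/-! ### Product likelihoods along a history. -/

section Likelihood

variable {X : Type*}

/-- Likelihood ratio of a history, given the density of one round. -/
noncomputable def likelihood (h : X → ℝ) {t : ℕ} (w : Fin t → X) : ℝ :=
  ∏ i, h (w i)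

@[simp]
theorem likelihood_snoc (h : X → ℝ) {t : ℕ} (w : Fin t → X) (r : X) :
    likelihood h (Fin.snoc w r : Fin (t + 1) → X) = likelihood h w * h r := by
  simp [likelihood, Fin.prod_univ_castSucc]

theorem measurable_likelihood [MeasurableSpace X] {h : X → ℝ} (hh : Measurable h) (t : ℕ) :
    Measurable (likelihood h : (Fin t → X) → ℝ) := by
  unfold likelihood; fun_prop

theorem likelihood_nonneg {h : X → ℝ} (h0 : ∀ z, 0 ≤ h z) {t : ℕ}
    (w : Fin t → X) : 0 ≤ likelihood h w :=
  Finset.prod_nonneg fun _ _ ↦ h0 _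

theorem likelihood_le {h : X → ℝ} (h0 : ∀ z, 0 ≤ h z) {b : ℝ} (h1 : ∀ z, h z ≤ b) {t : ℕ}
    (w : Fin t → X) : likelihood h w ≤ b ^ t := by
  refine (Finset.prod_le_prod (fun i _ ↦ h0 (w i)) fun i _ ↦ h1 (w i)).trans ?_
  simp

end Likelihood

/-! ### History laws, decision laws and likelihood ratios. -/

section Interaction

variable {D O : Type*} [MeasurableSpace D] [MeasurableSpace O]

theorem measurable_snoc_assoc (t : ℕ) :
    Measurable (fun z : ((Fin t → Round D O) × D) × (unitInterval × O) ↦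
      (Fin.snoc z.1.1 (z.1.2, z.2) : Fin (t + 1) → Round D O)) :=
  (measurable_snoc t).comp
    (measurable_fst.fst.prodMk (measurable_fst.snd.prodMk measurable_snd))

instance isProbabilityMeasure_historyLaw (M : Model D O) (a : Algorithm D O) (t : ℕ) :
    IsProbabilityMeasure (historyLaw M a t) := by
  induction t with
  | zero => unfold historyLaw; infer_instance
  | succ t ih =>
    unfold historyLaw roundKernel
    exact Measure.isProbabilityMeasure_map (measurable_snoc t).aemeasurable

/-- Regrouping as (history, decision) followed by the outcome isolates the only factor that depends
on the model, which is where a kernel density can be inserted. -/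
theorem historyLaw_succ (M : Model D O) (a : Algorithm D O) (t : ℕ) :
    historyLaw M a (t + 1) =
      ((historyLaw M a t ⊗ₘ a.policy t) ⊗ₘ (M.kernel.comap Prod.snd measurable_snd)).map
        (fun z ↦ (Fin.snoc z.1.1 (z.1.2, z.2) : Fin (t + 1) → Round D O)) := by
  refine Measure.ext_of_lintegral _ fun F hF ↦ ?_
  have h1 : Measurable fun z : (Fin t → Round D O) × Round D O ↦
      F (Fin.snoc z.1 z.2 : Fin (t + 1) → Round D O) := hF.comp (measurable_snoc t)
  have h2 : Measurable fun z : ((Fin t → Round D O) × D) × (unitInterval × O) ↦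
      F (Fin.snoc z.1.1 (z.1.2, z.2) : Fin (t + 1) → Round D O) :=
    hF.comp (measurable_snoc_assoc t)
  have h3 : Measurable fun z : (Fin t → Round D O) × D ↦
      ∫⁻ y, F (Fin.snoc z.1 (z.2, y) : Fin (t + 1) → Round D O) ∂(M.kernel z.2) :=
    Measurable.lintegral_kernel_prod_right' (κ := M.kernel.comap Prod.snd measurable_snd) h2
  rw [historyLaw, lintegral_map hF (measurable_snoc t), lintegral_map hF (measurable_snoc_assoc t),
    roundKernel, Measure.lintegral_compProd h1, Measure.lintegral_compProd h2]
  simp only [Kernel.comap_apply]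
  rw [Measure.lintegral_compProd h3]
  refine lintegral_congr fun h ↦ ?_
  have := Kernel.lintegral_compProd (a.policy t) (M.kernel.prodMkLeft (Fin t → Round D O)) h
    (h1.comp (measurable_prodMk_left (x := h)))
  exact this

theorem lintegral_historyLaw_succ (M : Model D O) (a : Algorithm D O) (t : ℕ)
    {F : (Fin (t + 1) → Round D O) → ℝ≥0∞} (hF : Measurable F) :
    ∫⁻ h, F h ∂(historyLaw M a (t + 1)) =
      ∫⁻ z, ∫⁻ y, F (Fin.snoc z.1 (z.2, y) : Fin (t + 1) → Round D O) ∂(M.kernel z.2)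
        ∂(historyLaw M a t ⊗ₘ a.policy t) := by
  rw [historyLaw_succ, lintegral_map hF (measurable_snoc_assoc t)]
  exact Measure.lintegral_compProd (hF.comp (measurable_snoc_assoc t))

theorem integral_historyLaw_succ (M : Model D O) (a : Algorithm D O) (t : ℕ)
    {F : (Fin (t + 1) → Round D O) → ℝ} (hF : Measurable F)
    (hi : Integrable F (historyLaw M a (t + 1))) :
    Integrable (fun z ↦ ∫ y, F (Fin.snoc z.1 (z.2, y) : Fin (t + 1) → Round D O) ∂(M.kernel z.2))
        (historyLaw M a t ⊗ₘ a.policy t) ∧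
    ∫ h, F h ∂(historyLaw M a (t + 1)) =
      ∫ z, ∫ y, F (Fin.snoc z.1 (z.2, y) : Fin (t + 1) → Round D O) ∂(M.kernel z.2)
        ∂(historyLaw M a t ⊗ₘ a.policy t) := by
  rw [historyLaw_succ, integrable_map_measure hF.aestronglyMeasurable
    (measurable_snoc_assoc t).aemeasurable] at hi
  refine ⟨?_, ?_⟩
  · have := hi.integral_compProd
    simpa using this
  · rw [historyLaw_succ, integral_map (measurable_snoc_assoc t).aemeasurable
      hF.aestronglyMeasurable]
    exact Measure.integral_compProd hi

/-- The sum over the first `T` rounds of the laws of the decisions. -/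
noncomputable def decisionMeasure (M : Model D O) (a : Algorithm D O) (T : ℕ) : Measure D :=
  ∑ t ∈ Finset.range T, (historyLaw M a t ⊗ₘ a.policy t).snd

instance isFiniteMeasure_decisionMeasure (M : Model D O) (a : Algorithm D O) (T : ℕ) :
    IsFiniteMeasure (decisionMeasure M a T) := by
  unfold decisionMeasure; infer_instance

theorem snd_absolutelyContinuous_decisionMeasure (M : Model D O) (a : Algorithm D O) {t T : ℕ}
    (ht : t < T) : (historyLaw M a t ⊗ₘ a.policy t).snd ≪ decisionMeasure M a T := by
  refine Measure.AbsolutelyContinuous.mk fun s _ h0 ↦ ?_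
  rw [decisionMeasure, Measure.finsetSum_apply, Finset.sum_eq_zero_iff] at h0
  exact h0 t (Finset.mem_range.2 ht)

theorem decisionMeasure_univ (M : Model D O) (a : Algorithm D O) (T : ℕ) :
    decisionMeasure M a T Set.univ = T := by
  rw [decisionMeasure, Measure.finsetSum_apply]
  simp

theorem lintegral_sum_decision (M : Model D O) (a : Algorithm D O) (T : ℕ)
    {G : D → ℝ≥0∞} (hG : Measurable G) :
    ∫⁻ h, ∑ i, G (h i).1 ∂(historyLaw M a T) = ∫⁻ x, G x ∂(decisionMeasure M a T) := by
  have hm : ∀ t, Measurable fun h : Fin t → Round D O ↦ ∑ i, G (h i).1 := fun t ↦ by fun_prop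
  induction T with
  | zero => simp [decisionMeasure]
  | succ t ih =>
    rw [lintegral_historyLaw_succ _ _ _ (hm _), decisionMeasure, Finset.sum_range_succ,
      ← decisionMeasure, lintegral_add_measure, ← ih, Measure.snd, lintegral_map hG measurable_snd]
    simp only [Fin.sum_univ_castSucc, Fin.snoc_castSucc, Fin.snoc_last, lintegral_const,
      measure_univ, mul_one]
    rw [lintegral_add_right _ (by fun_prop), Measure.lintegral_compProd
      (f := fun z : (Fin t → Round D O) × D ↦ ∑ i, G (z.1 i).1) (by fun_prop)]
    simp

theorem integral_sum_decision (M : Model D O) (a : Algorithm D O) (T : ℕ)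
    {G : D → ℝ} (hG : Measurable G) (hG0 : ∀ x, 0 ≤ G x) :
    ∫ h, ∑ i, G (h i).1 ∂(historyLaw M a T) = ∫ x, G x ∂(decisionMeasure M a T) := by
  have hm : Measurable fun h : Fin T → Round D O ↦ ∑ i, G (h i).1 := by fun_prop
  rw [integral_eq_lintegral_of_nonneg_ae
      (.of_forall fun h ↦ Finset.sum_nonneg fun i _ ↦ hG0 _) hm.aestronglyMeasurable,
    integral_eq_lintegral_of_nonneg_ae (.of_forall hG0) (by fun_prop),
    ← lintegral_sum_decision _ _ _ hG.ennreal_ofReal]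
  simp_rw [ENNReal.ofReal_sum_of_nonneg fun i _ ↦ hG0 _]

/-- The policy factors of the two history laws cancel, leaving one outcome density per round.
Domination by μ is required for decision laws under `R` only, since the law under `M` is rewritten
over that under `R` by induction before the density is used. -/
theorem historyLaw_eq_withDensity {M R : Model D O} {a : Algorithm D O} {μ : Measure D}
    {h : Round D O → ℝ} (H : IsKernelDensity μ M.kernel R.kernel h) {T : ℕ}
    (hμ : ∀ t < T, (historyLaw R a t ⊗ₘ a.policy t).snd ≪ μ) {t : ℕ} (ht : t ≤ T) :
    historyLaw M a t = (historyLaw R a t).withDensity fun w ↦ ENNReal.ofReal (likelihood h w) := by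
  induction t with
  | zero => simp [historyLaw, likelihood]
  | succ t ih =>
    have hm : ∀ t, Measurable fun w : Fin t → Round D O ↦ ENNReal.ofReal (likelihood h w) :=
      fun t ↦ (measurable_likelihood H.measurable t).ennreal_ofReal
    refine Measure.ext_of_lintegral _ fun F hF ↦ ?_
    have hF' : Measurable fun z : ((Fin t → Round D O) × D) × (unitInterval × O) ↦
        F (Fin.snoc z.1.1 (z.1.2, z.2) : Fin (t + 1) → Round D O) :=
      hF.comp (measurable_snoc_assoc t)
    have hFM : Measurable fun z : (Fin t → Round D O) × D ↦
        ∫⁻ y, F (Fin.snoc z.1 (z.2, y) : Fin (t + 1) → Round D O) ∂(M.kernel z.2) :=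
      Measurable.lintegral_kernel_prod_right' (κ := M.kernel.comap Prod.snd measurable_snd) hF'
    have hm1 : Measurable fun z : (Fin t → Round D O) × D ↦ ENNReal.ofReal (likelihood h z.1) :=
      (hm t).comp measurable_fst
    rw [lintegral_historyLaw_succ _ _ _ hF, lintegral_withDensity_eq_lintegral_mul _ (hm _) hF,
      lintegral_historyLaw_succ _ _ _ ((hm _).mul hF), Measure.lintegral_compProd hFM,
      ih (by omega), lintegral_withDensity_eq_lintegral_mul _ (hm _)
        hFM.lintegral_kernel_prod_right']
    have e1 : ∀ w : Fin t → Round D O,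
        ((fun w : Fin t → Round D O ↦ ENNReal.ofReal (likelihood h w)) *
        (fun w ↦ ∫⁻ x, ∫⁻ y, F (Fin.snoc w (x, y) : Fin (t + 1) → Round D O) ∂(M.kernel x)
          ∂(a.policy t w) : (Fin t → Round D O) → ℝ≥0∞)) w = ∫⁻ x, ∫⁻ y,
            ENNReal.ofReal (likelihood h w) * F (Fin.snoc w (x, y) : Fin (t + 1) → Round D O)
              ∂(M.kernel x) ∂(a.policy t w) := by
      intro w
      rw [Pi.mul_apply, ← lintegral_const_mul' _ _ ENNReal.ofReal_ne_top]
      refine lintegral_congr fun x ↦ ?_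
      rw [lintegral_const_mul' _ _ ENNReal.ofReal_ne_top]
    have hG : Measurable fun z : ((Fin t → Round D O) × D) × (unitInterval × O) ↦
        ENNReal.ofReal (likelihood h z.1.1) *
          F (Fin.snoc z.1.1 (z.1.2, z.2) : Fin (t + 1) → Round D O) :=
      (hm1.comp measurable_fst).mul hF'
    have hGM : Measurable fun z : (Fin t → Round D O) × D ↦
        ∫⁻ y, ENNReal.ofReal (likelihood h z.1) *
          F (Fin.snoc z.1 (z.2, y) : Fin (t + 1) → Round D O) ∂(M.kernel z.2) :=
      Measurable.lintegral_kernel_prod_right' (κ := M.kernel.comap Prod.snd measurable_snd) hG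
    rw [lintegral_congr e1, ← Measure.lintegral_compProd hGM]
    rw [H.lintegral_comap (q := historyLaw R a t ⊗ₘ a.policy t) measurable_snd
      (hμ t (by omega)) hG]
    refine lintegral_congr fun z ↦ lintegral_congr fun y ↦ ?_
    rw [Pi.mul_apply, likelihood_snoc, ENNReal.ofReal_mul (likelihood_nonneg H.nonneg _)]
    ring

end Interaction

theorem likelihood_le_one {D X : Type*} {α : D → ℝ} (hα0 : ∀ x, 0 ≤ α x) (hα1 : ∀ x, α x ≤ 1)
    {t : ℕ} (w : Fin t → D × X) : likelihood (fun r ↦ α r.1) w ≤ 1 := by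
  simpa using likelihood_le (h := fun r : D × X ↦ α r.1) (b := 1) (fun r ↦ hα0 _)
    (fun r ↦ hα1 _) w

/-! ### Change of measure with information measured under one model only. -/

section ChangeOfMeasure

variable {D O : Type*} [MeasurableSpace D] [MeasurableSpace O]

/-- The even mixture of two models. -/
noncomputable def Model.midpoint (M N : Model D O) : Model D O where
  kernel :=
    { toFun := fun x ↦ (2⁻¹ : ℝ≥0∞) • (M.kernel x + N.kernel x)
      measurable' := Measure.measurable_of_measurable_coe _ fun s hs ↦ by
        simp only [Measure.smul_apply, Measure.add_apply, smul_eq_mul]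
        exact ((M.kernel.measurable_coe hs).add (N.kernel.measurable_coe hs)).const_mul _ }
  isMarkovKernel := ⟨fun x ↦ ⟨by
    change ((2⁻¹ : ℝ≥0∞) • (M.kernel x + N.kernel x)) Set.univ = 1
    simp only [Measure.smul_apply, Measure.add_apply, smul_eq_mul, measure_univ]
    rw [one_add_one_eq_two]
    exact ENNReal.inv_mul_cancel (by simp) (by simp)⟩⟩

theorem Model.two_smul_midpoint (M N : Model D O) (x : D) :
    (2 : ℝ≥0∞) • (M.midpoint N).kernel x = M.kernel x + N.kernel x := by
  change (2 : ℝ≥0∞) • (2⁻¹ : ℝ≥0∞) • (M.kernel x + N.kernel x) = _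
  rw [smul_smul, ENNReal.mul_inv_cancel (by simp) (by simp), one_smul]

/-- Weighted combination of the affinity, the information and the likelihood of a history, whose
expectation under the base model does not decrease from one round to the next. -/
noncomputable def potential (h k : Round D O → ℝ) (α : D → ℝ) (l : ℝ) {t : ℕ}
    (w : Fin t → Round D O) : ℝ :=
  √(likelihood h w * likelihood k w) * likelihood (fun r ↦ α r.1) w
    + l / 2 * (likelihood k w * ∑ i, (1 - α (w i).1 ^ 2))
    - 1 / (2 * l) * (likelihood h w * likelihood (fun r ↦ α r.1) w ^ 2)

variable {μ : Measure D} {M N R : Model D O} {h k : Round D O → ℝ} {α : D → ℝ} {a : Algorithm D O}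

theorem IsKernelDensity.ae_integral_eq_one [IsFiniteMeasure μ]
    (H : IsKernelDensity μ M.kernel R.kernel h) : ∀ᵐ x ∂μ, ∫ y, h (x, y) ∂(R.kernel x) = 1 := by
  filter_upwards [H.ae_integral_eq (G := fun _ ↦ 1) measurable_const fun _ ↦ zero_le_one]
    with x hx
  simpa using hx.symm

theorem IsKernelDensity.integrable (H : IsKernelDensity μ M.kernel R.kernel h) (x : D) :
    Integrable (fun y ↦ h (x, y)) (R.kernel x) :=
  Integrable.of_bound (H.measurable.comp measurable_prodMk_left).aestronglyMeasurable 2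
    (.of_forall fun y ↦ by
      rw [Real.norm_eq_abs, abs_of_nonneg (H.nonneg _)]; exact H.le_two _)

theorem IsKernelDensity.integrable_sqrt_mul (H : IsKernelDensity μ M.kernel R.kernel h)
    (K : IsKernelDensity μ N.kernel R.kernel k) (x : D) :
    Integrable (fun y ↦ √(h (x, y) * k (x, y))) (R.kernel x) := by
  have hm : Measurable fun z ↦ √(h z * k z) := (H.measurable.mul K.measurable).sqrt
  refine Integrable.of_bound (hm.comp measurable_prodMk_left).aestronglyMeasurable 2
    (.of_forall fun y ↦ ?_)
  rw [Real.norm_eq_abs, abs_of_nonneg (Real.sqrt_nonneg _), Real.sqrt_le_left (by norm_num)]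
  nlinarith [H.nonneg (x, y), H.le_two (x, y), K.nonneg (x, y), K.le_two (x, y)]

theorem IsKernelDensity.integrable_likelihood (H : IsKernelDensity μ M.kernel R.kernel h) (t : ℕ) :
    Integrable (fun w : Fin t → Round D O ↦ likelihood h w) (historyLaw R a t) :=
  Integrable.of_bound (measurable_likelihood H.measurable t).aestronglyMeasurable (2 ^ t)
    (.of_forall fun w ↦ by
      rw [Real.norm_eq_abs, abs_of_nonneg (likelihood_nonneg H.nonneg _)]
      exact likelihood_le H.nonneg H.le_two w)

theorem IsKernelDensity.integrable_sqrt_likelihood (H : IsKernelDensity μ M.kernel R.kernel h)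
    (K : IsKernelDensity μ N.kernel R.kernel k) (t : ℕ) :
    Integrable (fun w : Fin t → Round D O ↦ √(likelihood h w * likelihood k w))
      (historyLaw R a t) := by
  have hm : Measurable fun w : Fin t → Round D O ↦ √(likelihood h w * likelihood k w) :=
    ((measurable_likelihood H.measurable t).mul (measurable_likelihood K.measurable t)).sqrt
  refine Integrable.of_bound hm.aestronglyMeasurable (2 ^ t) (.of_forall fun w ↦ ?_)
  rw [Real.norm_eq_abs, abs_of_nonneg (Real.sqrt_nonneg _), Real.sqrt_le_left (by positivity), sq]
  exact mul_le_mul (likelihood_le H.nonneg H.le_two w) (likelihood_le K.nonneg K.le_two w)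
    (likelihood_nonneg K.nonneg _) (by positivity)

theorem measurable_sum_decision {g : D → ℝ} (hg : Measurable g) (t : ℕ) :
    Measurable fun w : Fin t → Round D O ↦ ∑ i, g (w i).1 := by
  fun_prop

theorem integrable_information (K : IsKernelDensity μ N.kernel R.kernel k)
    (hα : Measurable α) (hα0 : ∀ x, 0 ≤ α x) (hα1 : ∀ x, α x ≤ 1) (t : ℕ) :
    Integrable (fun w : Fin t → Round D O ↦ likelihood k w * ∑ i, (1 - α (w i).1 ^ 2))
      (historyLaw R a t) := by
  refine (K.integrable_likelihood t).mul_bdd (c := t) (measurable_sum_decision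
    (g := fun x ↦ 1 - α x ^ 2) (by fun_prop) t).aestronglyMeasurable (.of_forall fun w ↦ ?_)
  have h1 : ∀ i, 0 ≤ 1 - α (w i).1 ^ 2 := fun i ↦ by nlinarith [hα0 (w i).1, hα1 (w i).1]
  rw [Real.norm_eq_abs, abs_of_nonneg (Finset.sum_nonneg fun i _ ↦ h1 i)]
  calc ∑ i, (1 - α (w i).1 ^ 2) ≤ ∑ _i : Fin t, (1 : ℝ) :=
        Finset.sum_le_sum fun i _ ↦ by nlinarith [hα0 (w i).1]
    _ = t := by simp

theorem integrable_potential (H : IsKernelDensity μ M.kernel R.kernel h)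
    (K : IsKernelDensity μ N.kernel R.kernel k) (hα : Measurable α) (hα0 : ∀ x, 0 ≤ α x)
    (hα1 : ∀ x, α x ≤ 1) (l : ℝ) (t : ℕ) :
    Measurable (potential h k α l : (Fin t → Round D O) → ℝ) ∧
      Integrable (potential h k α l) (historyLaw R a t) := by
  have hAm : Measurable fun w : Fin t → Round D O ↦ likelihood (fun r ↦ α r.1) w :=
    measurable_likelihood (hα.comp measurable_fst) t
  have hHm : Measurable fun w : Fin t → Round D O ↦ likelihood h w :=
    measurable_likelihood H.measurable t
  have hKm : Measurable fun w : Fin t → Round D O ↦ likelihood k w :=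
    measurable_likelihood K.measurable t
  have hA0 : ∀ w : Fin t → Round D O, 0 ≤ likelihood (fun r ↦ α r.1) w := fun w ↦
    likelihood_nonneg (h := fun r : Round D O ↦ α r.1) (fun r ↦ hα0 _) w
  have hA1 : ∀ w : Fin t → Round D O, likelihood (fun r ↦ α r.1) w ≤ 1 := fun w ↦
    likelihood_le_one hα0 hα1 w
  have hSm := measurable_sum_decision (O := O) (g := fun x ↦ 1 - α x ^ 2) (by fun_prop) t
  refine ⟨?_, ?_⟩
  · unfold potential
    exact (((hHm.mul hKm).sqrt.mul hAm).add ((hKm.mul hSm).const_mul _)).sub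
      ((hHm.mul (hAm.pow_const 2)).const_mul _)
  · have i1 : Integrable (fun w : Fin t → Round D O ↦
        √(likelihood h w * likelihood k w) * likelihood (fun r ↦ α r.1) w) (historyLaw R a t) :=
      (H.integrable_sqrt_likelihood K t).mul_bdd (c := 1) hAm.aestronglyMeasurable
        (.of_forall fun w ↦ by rw [Real.norm_eq_abs, abs_of_nonneg (hA0 w)]; exact hA1 w)
    have i3 : Integrable (fun w : Fin t → Round D O ↦
        likelihood h w * likelihood (fun r ↦ α r.1) w ^ 2) (historyLaw R a t) :=
      (H.integrable_likelihood t).mul_bdd (c := 1) (hAm.pow_const 2).aestronglyMeasurable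
        (.of_forall fun w ↦ by
          rw [Real.norm_eq_abs, abs_of_nonneg (sq_nonneg _)]
          exact pow_le_one₀ (hA0 w) (hA1 w))
    exact (i1.add ((integrable_information K hα hα0 hα1 t).const_mul _)).sub (i3.const_mul _)

/-- Here α is the one-round affinity. In conditional mean, √(HK)·A is multiplied by α², where H, K
are the likelihoods and A is the product of past α. The loss (1 - α²)√(HK)·A splits by AM-GM into a
term in K, which is information under `N`, and a term in H·A². The latter is exactly the decrease of
H·A² in conditional mean, so it telescopes; this is the purpose of the weight A, and no information
bound under `M` is needed. -/
theorem le_integral_potential [IsFiniteMeasure μ] (H : IsKernelDensity μ M.kernel R.kernel h)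
    (K : IsKernelDensity μ N.kernel R.kernel k) (hα : Measurable α) (hα0 : ∀ x, 0 ≤ α x)
    (hα1 : ∀ x, α x ≤ 1)
    (hαe : ∀ᵐ x ∂μ, α x = ∫ y, √(h (x, y) * k (x, y)) ∂(R.kernel x))
    {l : ℝ} (hl : 0 < l) {T : ℕ}
    (hμ : ∀ t < T, (historyLaw R a t ⊗ₘ a.policy t).snd ≪ μ) {t : ℕ} (ht : t ≤ T) :
    1 - 1 / (2 * l) ≤ ∫ w, potential h k α l w ∂(historyLaw R a t) := by
  induction t with
  | zero => simp [potential, likelihood]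
  | succ t ih =>
    refine (ih (by omega)).trans ?_
    obtain ⟨hPm, hPi⟩ := integrable_potential (a := a) H K hα hα0 hα1 l (t + 1)
    obtain ⟨hPm', hPi'⟩ := integrable_potential (a := a) H K hα hα0 hα1 l t
    obtain ⟨hi, he⟩ := integral_historyLaw_succ R a t hPm hPi
    have hfst : (historyLaw R a t ⊗ₘ a.policy t).map Prod.fst = historyLaw R a t :=
      Measure.fst_compProd _ _
    rw [he]
    have h0 : ∫ w, potential h k α l w ∂(historyLaw R a t)
        = ∫ z, potential h k α l z.1 ∂(historyLaw R a t ⊗ₘ a.policy t) := by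
      conv_lhs => rw [← hfst]
      rw [integral_map measurable_fst.aemeasurable hPm'.aestronglyMeasurable]
    rw [h0]
    have hPi'' : Integrable (fun z ↦ potential h k α l z.1)
        (historyLaw R a t ⊗ₘ a.policy t) := by
      rw [← hfst] at hPi'
      exact hPi'.comp_measurable measurable_fst
    refine integral_mono_ae hPi'' hi ?_
    have hae : ∀ᵐ z ∂(historyLaw R a t ⊗ₘ a.policy t),
        α z.2 = ∫ y, √(h (z.2, y) * k (z.2, y)) ∂(R.kernel z.2) ∧
          ∫ y, h (z.2, y) ∂(R.kernel z.2) = 1 ∧ ∫ y, k (z.2, y) ∂(R.kernel z.2) = 1 := by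
      have hD : ∀ᵐ x ∂μ, α x = ∫ y, √(h (x, y) * k (x, y)) ∂(R.kernel x) ∧
          ∫ y, h (x, y) ∂(R.kernel x) = 1 ∧ ∫ y, k (x, y) ∂(R.kernel x) = 1 :=
        hαe.and (H.ae_integral_eq_one.and K.ae_integral_eq_one)
      exact ae_of_ae_map measurable_snd.aemeasurable ((hμ t (by omega)).ae_le hD)
    filter_upwards [hae] with z ⟨hz1, hz2, hz3⟩
    obtain ⟨w, x⟩ := z
    dsimp only at hz1 hz2 hz3 ⊢
    set A := likelihood (fun r : Round D O ↦ α r.1) w with hA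
    set S := ∑ i, (1 - α (w i).1 ^ 2) with hS
    have hH0 := likelihood_nonneg H.nonneg w
    have hK0 := likelihood_nonneg K.nonneg w
    have hexp : ∀ y, potential h k α l (Fin.snoc w (x, y) : Fin (t + 1) → Round D O)
        = √(likelihood h w * likelihood k w) * A * α x * √(h (x, y) * k (x, y))
          + l / 2 * (likelihood k w * (S + (1 - α x ^ 2))) * k (x, y)
          - 1 / (2 * l) * (likelihood h w * A ^ 2 * α x ^ 2) * h (x, y) := by
      intro y
      simp only [potential, likelihood_snoc, Fin.sum_univ_castSucc, Fin.snoc_castSucc,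
        Fin.snoc_last]
      rw [mul_mul_mul_comm, Real.sqrt_mul (mul_nonneg hH0 hK0)]
      ring
    simp_rw [hexp]
    have i1 := (H.integrable_sqrt_mul K x).const_mul
      (√(likelihood h w * likelihood k w) * A * α x)
    have i2 := (K.integrable x).const_mul (l / 2 * (likelihood k w * (S + (1 - α x ^ 2))))
    have i3 := (H.integrable x).const_mul (1 / (2 * l) * (likelihood h w * A ^ 2 * α x ^ 2))
    have i12 : Integrable (fun y ↦ √(likelihood h w * likelihood k w) * A * α x
        * √(h (x, y) * k (x, y)) + l / 2 * (likelihood k w * (S + (1 - α x ^ 2))) * k (x, y))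
        (R.kernel x) := i1.add i2
    rw [integral_sub i12 i3, integral_add i1 i2, integral_const_mul, integral_const_mul,
      integral_const_mul, ← hz1, hz2, hz3]
    simp only [potential, ← hA, ← hS]
    rw [Real.sqrt_mul hH0]
    have hb : 0 ≤ 1 - α x ^ 2 := by nlinarith [hα0 x, hα1 x]
    have e1 := Real.sq_sqrt hH0
    have e2 := Real.sq_sqrt hK0
    set u := √(likelihood h w)
    set v := √(likelihood k w)
    rw [← e1, ← e2]
    -- This square is the conditional increment of the potential.
    have key : 0 ≤ (1 - α x ^ 2) * (l * v - u * A) ^ 2 / (2 * l) := by positivity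
    have key2 : (1 - α x ^ 2) * (l * v - u * A) ^ 2 / (2 * l) =
        (u * v * A * α x * α x + l / 2 * (v ^ 2 * (S + (1 - α x ^ 2))) * 1
          - 1 / (2 * l) * (u ^ 2 * A ^ 2 * α x ^ 2) * 1)
        - (u * v * A + l / 2 * (v ^ 2 * S) - 1 / (2 * l) * (u ^ 2 * A ^ 2)) := by
      field_simp
      ring
    linarith

/-- If the expected squared Hellinger information gathered while interacting with `N` is small, then
interacting with `M` produces a nearby history. -/
theorem abs_integral_historyLaw_sub_le (M N : Model D O) (a : Algorithm D O) (T : ℕ) {δ : ℝ}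
    (hδ0 : 0 ≤ δ)
    (hδ : ∫⁻ x, hellingerSq (M.kernel x) (N.kernel x) ∂(decisionMeasure N a T) ≤ ENNReal.ofReal δ)
    {F : (Fin T → Round D O) → ℝ} (hF : Measurable F) (hF1 : ∀ w, |F w| ≤ 1)
    {l m : ℝ} (hl : 0 < l) (hm : 0 < m) :
    |∫ w, F w ∂(historyLaw M a T) - ∫ w, F w ∂(historyLaw N a T)|
      ≤ m / 2 * (1 / l + l * δ) + 2 / m := by
  -- Both models are dominated by twice their midpoint, so both densities are bounded by 2.
  set R := M.midpoint N with hR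
  set μ := decisionMeasure R a T with hμdef
  obtain ⟨h, H⟩ := exists_isKernelDensity μ M.kernel R.kernel fun x ↦ by
    rw [M.two_smul_midpoint N x]; exact Measure.le_add_right le_rfl
  obtain ⟨k, K⟩ := exists_isKernelDensity μ N.kernel R.kernel fun x ↦ by
    rw [M.two_smul_midpoint N x]; exact Measure.le_add_left le_rfl
  have hμ : ∀ t < T, (historyLaw R a t ⊗ₘ a.policy t).snd ≪ μ := fun t ht ↦
    snd_absolutelyContinuous_decisionMeasure R a ht
  have hsm : Measurable fun z ↦ √(h z * k z) := (H.measurable.mul K.measurable).sqrt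
  have him : Measurable fun x ↦ ∫ y, √(h (x, y) * k (x, y)) ∂(R.kernel x) :=
    (hsm.stronglyMeasurable.integral_kernel_prod_right' (κ := R.kernel)).measurable
  have hi0 : ∀ x, 0 ≤ ∫ y, √(h (x, y) * k (x, y)) ∂(R.kernel x) := fun x ↦
    integral_nonneg fun y ↦ Real.sqrt_nonneg _
  -- The affinity is at most 1 only where both densities integrate to 1, that is, almost everywhere;
  -- the minimum enforces it at every decision.
  set α : D → ℝ := fun x ↦ min (∫ y, √(h (x, y) * k (x, y)) ∂(R.kernel x)) 1 with hαdef
  have hα : Measurable α := him.min measurable_const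
  have hα0 : ∀ x, 0 ≤ α x := fun x ↦ le_min (hi0 x) zero_le_one
  have hα1 : ∀ x, α x ≤ 1 := fun x ↦ min_le_right _ _
  have hαe : ∀ᵐ x ∂μ, α x = ∫ y, √(h (x, y) * k (x, y)) ∂(R.kernel x) := by
    filter_upwards [H.ae_integral_eq_one, K.ae_integral_eq_one] with x h1 h2
    refine min_eq_left ?_
    calc ∫ y, √(h (x, y) * k (x, y)) ∂(R.kernel x)
        ≤ ∫ y, (1 / 2 * h (x, y) + 1 / 2 * k (x, y)) ∂(R.kernel x) := by
          refine integral_mono (H.integrable_sqrt_mul K x)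
            (((H.integrable x).const_mul _).add ((K.integrable x).const_mul _)) fun y ↦ ?_
          have := sqrt_sub_sqrt_sq (H.nonneg (x, y)) (K.nonneg (x, y))
          dsimp only
          nlinarith [sq_nonneg (√(h (x, y)) - √(k (x, y)))]
      _ = 1 := by
          rw [integral_add ((H.integrable x).const_mul _) ((K.integrable x).const_mul _),
            integral_const_mul, integral_const_mul, h1, h2]
          norm_num
  have hMd := historyLaw_eq_withDensity H hμ le_rfl
  have hNd := historyLaw_eq_withDensity K hμ le_rfl
  have conv : ∀ {M' : Model D O} {g : Round D O → ℝ} (_ : IsKernelDensity μ M'.kernel R.kernel g)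
      (_ : historyLaw M' a T = (historyLaw R a T).withDensity fun w ↦
        ENNReal.ofReal (likelihood g w)) (G : (Fin T → Round D O) → ℝ),
      ∫ w, G w ∂(historyLaw M' a T) = ∫ w, likelihood g w * G w ∂(historyLaw R a T) := by
    intro M' g hg hd G
    rw [hd, integral_withDensity_eq_integral_toReal_smul
      (measurable_likelihood hg.measurable T).ennreal_ofReal
      (.of_forall fun w ↦ ENNReal.ofReal_lt_top)]
    simp only [ENNReal.toReal_ofReal (likelihood_nonneg hg.nonneg _), smul_eq_mul]
  have hone : ∀ {M' : Model D O} {g : Round D O → ℝ}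
      (_ : IsKernelDensity μ M'.kernel R.kernel g)
      (_ : historyLaw M' a T = (historyLaw R a T).withDensity fun w ↦
        ENNReal.ofReal (likelihood g w)),
      ∫ w, likelihood g w ∂(historyLaw R a T) = 1 := by
    intro M' g hg hd
    simpa using (conv hg hd fun _ ↦ 1).symm
  have hac : decisionMeasure N a T ≪ μ := by
    refine Measure.AbsolutelyContinuous.mk fun s hs h0 ↦ ?_
    rw [hμdef, decisionMeasure, Measure.finsetSum_apply, Finset.sum_eq_zero_iff] at h0
    rw [decisionMeasure, Measure.finsetSum_apply, Finset.sum_eq_zero_iff]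
    intro t ht
    have hlt := Finset.mem_range.1 ht
    have hle : historyLaw N a t ≪ historyLaw R a t := by
      rw [historyLaw_eq_withDensity K hμ hlt.le]
      exact withDensity_absolutelyContinuous _ _
    have := (hle.compProd_left (a.policy t)).map (f := Prod.snd) measurable_snd
    exact this (h0 t ht)
  -- Under `N` this is the sum of 1 - α² over the decisions, and 1 - α² ≤ 2(1 - α), which is at most
  -- the squared Hellinger distance. Monotonicity suffices, so a lower integral of that distance is
  -- enough.
  have hinfo : ∫ w, likelihood k w * ∑ i, (1 - α (w i).1 ^ 2) ∂(historyLaw R a T) ≤ δ := by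
    have hb0 : ∀ x, 0 ≤ 1 - α x ^ 2 := fun x ↦ by nlinarith [hα0 x, hα1 x]
    rw [← conv K hNd, integral_sum_decision N a T (G := fun x ↦ 1 - α x ^ 2) (by fun_prop) hb0,
      integral_eq_lintegral_of_nonneg_ae (.of_forall hb0) (by fun_prop)]
    refine ENNReal.toReal_le_of_le_ofReal hδ0 (le_trans (lintegral_mono_ae ?_) hδ)
    filter_upwards [hac.ae_le hαe, hac.ae_le (H.ae_le_hellingerSq K)] with x h1 h2
    refine le_trans (ENNReal.ofReal_le_ofReal ?_) h2
    rw [← h1]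
    nlinarith [sq_nonneg (1 - α x)]
  have hpot := le_integral_potential (a := a) H K hα hα0 hα1 hαe hl hμ le_rfl
  have hsi := H.integrable_sqrt_likelihood K (a := a) T
  -- The negative term of the potential is dropped and A ≤ 1 removes the weight from the affinity.
  have haff : 1 - 1 / (2 * l) - l / 2 * δ
      ≤ ∫ w, √(likelihood h w * likelihood k w) ∂(historyLaw R a T) := by
    have h1 : ∫ w, potential h k α l w ∂(historyLaw R a T)
        ≤ ∫ w, (√(likelihood h w * likelihood k w)
          + l / 2 * (likelihood k w * ∑ i, (1 - α (w i).1 ^ 2))) ∂(historyLaw R a T) := by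
      have hii := (integrable_information (a := a) K hα hα0 hα1 T).const_mul (l / 2)
      refine integral_mono (integrable_potential H K hα hα0 hα1 l T).2 (hsi.add hii) fun w ↦ ?_
      have hA0 : 0 ≤ likelihood (fun r : Round D O ↦ α r.1) w :=
        likelihood_nonneg (h := fun r : Round D O ↦ α r.1) (fun r ↦ hα0 _) w
      have hA1 := likelihood_le_one hα0 hα1 w
      have hH0 := likelihood_nonneg H.nonneg w
      have h2 : 0 ≤ 1 / (2 * l) * (likelihood h w * likelihood (fun r ↦ α r.1) w ^ 2) := by
        positivity
      have h3 := mul_le_mul_of_nonneg_left hA1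
        (Real.sqrt_nonneg (likelihood h w * likelihood k w))
      dsimp only [potential]
      linarith
    rw [integral_add hsi ((integrable_information K hα hα0 hα1 T).const_mul _),
      integral_const_mul] at h1
    have h4 : l / 2 * ∫ w, likelihood k w * ∑ i, (1 - α (w i).1 ^ 2) ∂(historyLaw R a T)
        ≤ l / 2 * δ := mul_le_mul_of_nonneg_left hinfo (by positivity)
    linarith
  have hH0 : ∀ w : Fin T → Round D O, 0 ≤ likelihood h w := likelihood_nonneg H.nonneg
  have hK0 : ∀ w : Fin T → Round D O, 0 ≤ likelihood k w := likelihood_nonneg K.nonneg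
  have hHi := H.integrable_likelihood (a := a) T
  have hKi := K.integrable_likelihood (a := a) T
  have hfin := abs_integral_density_sub_le hHi hKi hH0 hK0
    (integrable_sqrt_sub_sqrt_sq hHi hKi (measurable_likelihood H.measurable T)
      (measurable_likelihood K.measurable T) hH0 hK0) (hone H hMd) (hone K hNd) hF hF1 hm
  rw [← conv H hMd, ← conv K hNd] at hfin
  have hsq : ∫ w, (√(likelihood h w) - √(likelihood k w)) ^ 2 ∂(historyLaw R a T)
      = 2 - 2 * ∫ w, √(likelihood h w * likelihood k w) ∂(historyLaw R a T) := by
    simp_rw [fun w ↦ sqrt_sub_sqrt_sq (hH0 w) (hK0 w)]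
    have hHKi : Integrable (fun w : Fin T → Round D O ↦ likelihood h w + likelihood k w)
      (historyLaw R a T) := hHi.add hKi
    rw [integral_sub hHKi (hsi.const_mul _), integral_add hHi hKi, integral_const_mul,
      hone H hMd, hone K hNd]
    norm_num
  rw [hsq] at hfin
  refine hfin.trans ?_
  have : 2 - 2 * ∫ w, √(likelihood h w * likelihood k w) ∂(historyLaw R a T)
      ≤ 1 / l + l * δ := by
    have e : 1 / (2 * l) = 1 / l / 2 := by field_simp
    rw [e] at haff
    linarith
  gcongr

end ChangeOfMeasure

/-! ### Sums stopped when a budget is exceeded. -/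

section StoppedSum

variable {D X : Type*}

/-- Sum of `g'` over the decisions taken while the sum of `g` over the earlier decisions is at most
`b`. -/
noncomputable def stoppedSum (g g' : D → ℝ) (b : ℝ) : (t : ℕ) → (Fin t → D × X) → ℝ
  | 0, _ => 0
  | t + 1, w => stoppedSum g g' b t (fun i ↦ w i.castSucc) +
      if ∑ i : Fin t, g (w i.castSucc).1 ≤ b then g' (w (Fin.last t)).1 else 0

theorem stoppedSum_snoc (g g' : D → ℝ) (b : ℝ) {t : ℕ} (w : Fin t → D × X) (r : D × X) :
    stoppedSum g g' b (t + 1) (Fin.snoc w r : Fin (t + 1) → D × X) =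
      stoppedSum g g' b t w + if ∑ i, g (w i).1 ≤ b then g' r.1 else 0 := by
  simp [stoppedSum]

variable {g g' e : D → ℝ} {b : ℝ}

theorem stoppedSum_nonneg (hg' : ∀ x, 0 ≤ g' x) (t : ℕ) (w : Fin t → D × X) :
    0 ≤ stoppedSum g g' b t w := by
  induction t with
  | zero => exact le_rfl
  | succ t ih =>
    rw [stoppedSum]
    have := ih fun i ↦ w i.castSucc
    have := hg' (w (Fin.last t)).1
    split_ifs <;> linarith

theorem stoppedSum_le_sum (hg' : ∀ x, 0 ≤ g' x) (t : ℕ) (w : Fin t → D × X) :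
    stoppedSum g g' b t w ≤ ∑ i, g' (w i).1 := by
  induction t with
  | zero => simp [stoppedSum]
  | succ t ih =>
    rw [stoppedSum, Fin.sum_univ_castSucc]
    have := ih fun i ↦ w i.castSucc
    have := hg' (w (Fin.last t)).1
    split_ifs <;> linarith

/-- The test looks at earlier decisions only, so the budget is overshot by at most one term. -/
theorem stoppedSum_self_le (hg0 : ∀ x, 0 ≤ g x) (hg1 : ∀ x, g x ≤ 1) (hb : 0 ≤ b) (t : ℕ)
    (w : Fin t → D × X) : stoppedSum g g b t w ≤ b + 1 := by
  have key : ∀ t : ℕ, ∀ w : Fin t → D × X, stoppedSum g g b t w ≤ ∑ i, g (w i).1 ∧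
      stoppedSum g g b t w ≤ b + 1 := by
    intro t w
    refine ⟨stoppedSum_le_sum hg0 t w, ?_⟩
    induction t with
    | zero => simp only [stoppedSum]; linarith
    | succ t ih =>
      rw [stoppedSum]
      have h1 := ih fun i ↦ w i.castSucc
      have h2 := stoppedSum_le_sum (g := g) (b := b) hg0 t fun i ↦ w i.castSucc
      have h3 := hg1 (w (Fin.last t)).1
      split_ifs with h <;> linarith
  exact (key t w).2

theorem le_stoppedSum_add_sum {c : ℝ} (hc : 0 ≤ c) (hg0 : ∀ x, 0 ≤ g x) (hg'0 : ∀ x, 0 ≤ g' x)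
    (he : ∀ x, 0 ≤ e x) (hge : ∀ x, g x + c ≤ g' x + e x) (t : ℕ) (w : Fin t → D × X) :
    min b (c * t) ≤ stoppedSum g g' b t w + ∑ i, e (w i).1 := by
  -- While the budget holds, every round has been counted and the pointwise inequality sums up. At
  -- the crossing round the same inequality still applies and already yields b; afterwards the right
  -- side can only grow.
  have key : (∑ i, g (w i).1 ≤ b →
        ∑ i, g (w i).1 + c * t ≤ stoppedSum g g' b t w + ∑ i, e (w i).1) ∧
      (b < ∑ i, g (w i).1 → b ≤ stoppedSum g g' b t w + ∑ i, e (w i).1) := by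
    induction t with
    | zero => simpa [stoppedSum] using le_of_lt
    | succ t ih =>
      obtain ⟨h1, h2⟩ := ih fun i ↦ w i.castSucc
      rw [stoppedSum]
      simp only [Fin.sum_univ_castSucc]
      set x := (w (Fin.last t)).1
      have := hg0 x
      have := hg'0 x
      have := he x
      have := hge x
      have hct : 0 ≤ c * t := by positivity
      push_cast
      rw [mul_add, mul_one]
      split_ifs with h
      · have := h1 h
        constructor <;> intro <;> linarith
      · have := h2 (not_le.1 h)
        refine ⟨fun h' ↦ absurd h' ?_, fun _ ↦ by linarith⟩
        have := not_le.1 h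
        rw [not_le]; linarith
  rcases le_or_gt (∑ i, g (w i).1) b with h | h
  · have := key.1 h
    have h0 : 0 ≤ ∑ i, g (w i).1 := Finset.sum_nonneg fun i _ ↦ hg0 _
    exact (min_le_right _ _).trans (by linarith)
  · exact (min_le_left _ _).trans (key.2 h)

theorem measurable_stoppedSum [MeasurableSpace D] [MeasurableSpace X] (hg : Measurable g)
    (hg' : Measurable g') (t : ℕ) :
    Measurable (stoppedSum g g' b t : (Fin t → D × X) → ℝ) := by
  induction t with
  | zero => exact measurable_const
  | succ t ih =>
    have h1 : Measurable fun w : Fin (t + 1) → D × X ↦ fun i : Fin t ↦ w i.castSucc := by fun_prop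
    have h2 : Measurable fun w : Fin (t + 1) → D × X ↦ ∑ i : Fin t, g (w i.castSucc).1 := by
      fun_prop
    have h3 : Measurable fun w : Fin (t + 1) → D × X ↦ g' (w (Fin.last t)).1 := by fun_prop
    exact (ih.comp h1).add (Measurable.ite (measurableSet_le h2 measurable_const) h3
      measurable_const)

end StoppedSum

/-! ### Gaps, expected regret and the stopped algorithm. -/

section Regret

variable {D O : Type*} [MeasurableSpace D] [MeasurableSpace O]

theorem integrable_reward {Y : Type*} [MeasurableSpace Y] (P : Measure (unitInterval × Y))
    [IsFiniteMeasure P] : Integrable (fun y ↦ (y.1 : ℝ)) P :=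
  Integrable.of_bound (measurable_fst.subtype_val).aestronglyMeasurable 1
    (.of_forall fun y ↦ by rw [Real.norm_eq_abs, abs_of_nonneg y.1.2.1]; exact y.1.2.2)

namespace Model

variable (M N : Model D O)

theorem measurable_meanReward : Measurable M.meanReward := by
  have : Measurable fun z : D × (unitInterval × O) ↦ (z.2.1 : ℝ) :=
    (measurable_snd.fst).subtype_val
  exact (this.stronglyMeasurable.integral_kernel_prod_right' (κ := M.kernel)).measurable

theorem meanReward_nonneg (x : D) : 0 ≤ M.meanReward x :=
  integral_nonneg fun y ↦ y.1.2.1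

theorem meanReward_le_one (x : D) : M.meanReward x ≤ 1 := by
  have := integral_mono (integrable_reward (M.kernel x)) (integrable_const (1 : ℝ))
    fun y ↦ y.1.2.2
  rw [integral_const, probReal_univ, one_smul] at this
  exact this

theorem bddAbove_meanReward : BddAbove (Set.range M.meanReward) :=
  ⟨1, by rintro _ ⟨x, rfl⟩; exact M.meanReward_le_one x⟩

theorem measurable_gap : Measurable M.gap :=
  measurable_const.sub M.measurable_meanReward

theorem gap_nonneg (x : D) : 0 ≤ M.gap x :=
  sub_nonneg.2 (le_ciSup M.bddAbove_meanReward x)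

theorem gap_le_one (x : D) : M.gap x ≤ 1 := by
  have : Nonempty D := ⟨x⟩
  have h1 : ⨆ x', M.meanReward x' ≤ 1 := ciSup_le M.meanReward_le_one
  have h2 := M.meanReward_nonneg x
  unfold gap; linarith

theorem integrable_gap (p : Measure D) [IsFiniteMeasure p] : Integrable M.gap p :=
  Integrable.of_bound M.measurable_gap.aestronglyMeasurable 1
    (.of_forall fun x ↦ by
      rw [Real.norm_eq_abs, abs_of_nonneg (M.gap_nonneg x)]; exact M.gap_le_one x)

theorem exists_gap_le [Nonempty D] {η : ℝ} (hη : 0 < η) : ∃ x, M.gap x ≤ η := by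
  obtain ⟨x, hx⟩ := exists_lt_of_lt_ciSup (sub_lt_self (⨆ x, M.meanReward x) hη)
  exact ⟨x, by unfold gap; linarith⟩

end Model

theorem regret_snoc (M : Model D O) (a : Algorithm D O) {t : ℕ} (w : Fin t → Round D O)
    (r : Round D O) : regret M a (t + 1) (Fin.snoc w r : Fin (t + 1) → Round D O) =
      regret M a t w + ∫ x, M.gap x ∂(a.policy t w) := by
  unfold regret
  rw [Fin.sum_univ_castSucc]
  congr 1
  · refine Finset.sum_congr rfl fun s _ ↦ ?_
    have : (fun i : Fin (s : ℕ) ↦ (Fin.snoc w r : Fin (t + 1) → Round D O)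
        (Fin.castLE (Fin.castSucc s).isLt.le i)) = fun i ↦ w (Fin.castLE s.isLt.le i) := by
      funext i
      exact Fin.snoc_castSucc (α := fun _ ↦ Round D O) r w (Fin.castLE s.isLt.le i)
    exact congrArg (fun v ↦ ∫ x, M.gap x ∂(a.policy (s : ℕ) v)) this
  · have : (fun i : Fin t ↦ (Fin.snoc w r : Fin (t + 1) → Round D O)
        (Fin.castLE (Fin.last t).isLt.le i)) = w := by
      funext i
      exact Fin.snoc_castSucc (α := fun _ ↦ Round D O) r w i
    exact congrArg (fun v ↦ ∫ x, M.gap x ∂(a.policy t v)) this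

theorem measurable_integral_gap (M : Model D O) (a : Algorithm D O) (t : ℕ) :
    Measurable fun w ↦ ∫ x, M.gap x ∂(a.policy t w) :=
  (StronglyMeasurable.integral_kernel_prod_right' (κ := a.policy t)
    (f := fun z : (Fin t → Round D O) × D ↦ M.gap z.2)
    (M.measurable_gap.comp measurable_snd).stronglyMeasurable).measurable

theorem measurable_regret (M : Model D O) (a : Algorithm D O) (T : ℕ) :
    Measurable (regret M a T) := by
  unfold regret
  refine Finset.measurable_sum _ fun t _ ↦ ?_
  exact (measurable_integral_gap M a t).comp (by fun_prop)

theorem regret_nonneg (M : Model D O) (a : Algorithm D O) (T : ℕ) (w : Fin T → Round D O) :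
    0 ≤ regret M a T w :=
  Finset.sum_nonneg fun _ _ ↦ integral_nonneg M.gap_nonneg

theorem lintegral_fst_compProd {α β : Type*} [MeasurableSpace α] [MeasurableSpace β]
    {ν : Measure α} [SFinite ν] {κ : Kernel α β} [IsMarkovKernel κ] {G : α → ℝ≥0∞}
    (hG : Measurable G) : ∫⁻ z, G z.1 ∂(ν ⊗ₘ κ) = ∫⁻ x, G x ∂ν := by
  have hG' : Measurable fun z : α × β ↦ G z.1 := hG.comp measurable_fst
  rw [Measure.lintegral_compProd hG']
  simp

theorem lintegral_snd_compProd {α β : Type*} [MeasurableSpace α] [MeasurableSpace β]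
    {ν : Measure α} [SFinite ν] {κ : Kernel α β} [IsSFiniteKernel κ] {G : β → ℝ≥0∞}
    (hG : Measurable G) : ∫⁻ x, G x ∂(ν ⊗ₘ κ).snd = ∫⁻ w, ∫⁻ x, G x ∂(κ w) ∂ν := by
  have hG' : Measurable fun z : α × β ↦ G z.2 := hG.comp measurable_snd
  rw [Measure.snd, lintegral_map hG measurable_snd, Measure.lintegral_compProd hG']

theorem lintegral_regret (M : Model D O) (a : Algorithm D O) (T : ℕ) :
    ∫⁻ w, ENNReal.ofReal (regret M a T w) ∂(historyLaw M a T)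
      = ∫⁻ x, ENNReal.ofReal (M.gap x) ∂(decisionMeasure M a T) := by
  induction T with
  | zero => simp [regret, decisionMeasure]
  | succ t ih =>
    rw [lintegral_historyLaw_succ _ _ _ (measurable_regret M a _).ennreal_ofReal,
      decisionMeasure, Finset.sum_range_succ, ← decisionMeasure, lintegral_add_measure, ← ih,
      lintegral_snd_compProd M.measurable_gap.ennreal_ofReal]
    simp only [regret_snoc, lintegral_const, measure_univ, mul_one]
    rw [lintegral_fst_compProd (G := fun w ↦ ENNReal.ofReal
      (regret M a t w + ∫ x, M.gap x ∂(a.policy t w)))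
      ((measurable_regret M a t).add (measurable_integral_gap M a t)).ennreal_ofReal]
    rw [← lintegral_add_left (measurable_regret M a t).ennreal_ofReal]
    refine lintegral_congr fun w ↦ ?_
    rw [ENNReal.ofReal_add (regret_nonneg M a t w) (integral_nonneg M.gap_nonneg),
      ofReal_integral_eq_lintegral_ofReal (M.integrable_gap _) (.of_forall M.gap_nonneg)]

/-- By the tower property, conditional mean gaps may be replaced by the gaps of the realized
decisions, a function of the history to which stopping applies. -/
theorem expectedRegret_eq_integral_sum_gap (M : Model D O) (a : Algorithm D O) (T : ℕ) :
    expectedRegret M a T = ∫ w, ∑ i, M.gap (w i).1 ∂(historyLaw M a T) := by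
  rw [integral_sum_decision _ _ _ M.measurable_gap M.gap_nonneg, expectedRegret,
    integral_eq_lintegral_of_nonneg_ae (.of_forall (regret_nonneg M a T))
      (measurable_regret M a T).aestronglyMeasurable, lintegral_regret,
    integral_eq_lintegral_of_nonneg_ae (.of_forall M.gap_nonneg)
      M.measurable_gap.aestronglyMeasurable]

open Classical in
/-- The algorithm that follows `a` as long as the sum of `g` over the past decisions is at most `b`,
and takes the decision `x₀` from then on. -/
noncomputable def Algorithm.stopAt (a : Algorithm D O) {g : D → ℝ} (hg : Measurable g) (b : ℝ)
    (x₀ : D) : Algorithm D O where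
  policy t := Kernel.piecewise
    (measurableSet_le (measurable_sum_decision (O := O) hg t) (measurable_const (a := b)))
    (a.policy t) (Kernel.const _ (Measure.dirac x₀))
  isMarkovKernel _ := inferInstance

variable {a : Algorithm D O} {g g' : D → ℝ} {hg : Measurable g} {b : ℝ} {x₀ : D}

theorem Algorithm.stopAt_policy_of_le {t : ℕ} {w : Fin t → Round D O}
    (h : ∑ i, g (w i).1 ≤ b) : (a.stopAt hg b x₀).policy t w = a.policy t w := by
  classical
  simp only [stopAt]
  rw [Kernel.piecewise_apply]
  exact if_pos h

theorem Algorithm.stopAt_policy_of_lt {t : ℕ} {w : Fin t → Round D O}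
    (h : b < ∑ i, g (w i).1) : (a.stopAt hg b x₀).policy t w = Measure.dirac x₀ := by
  classical
  simp only [stopAt]
  rw [Kernel.piecewise_apply, if_neg (by simpa using h), Kernel.const_apply]

theorem measurable_ite_sum_le (hg : Measurable g) (b : ℝ) {t : ℕ}
    {F : (Fin t → Round D O) → ℝ≥0∞} (hF : Measurable F) :
    Measurable fun w ↦ if ∑ i, g (w i).1 ≤ b then F w else 0 :=
  Measurable.ite (measurableSet_le (measurable_sum_decision hg t) measurable_const) hF
    measurable_const

/-- Before the stopping time the stopped algorithm produces the same histories. -/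
theorem lintegral_stopAt (M : Model D O) (hg0 : ∀ x, 0 ≤ g x) {t : ℕ}
    {F : (Fin t → Round D O) → ℝ≥0∞} (hF : Measurable F) :
    ∫⁻ w, (if ∑ i, g (w i).1 ≤ b then F w else 0) ∂(historyLaw M (a.stopAt hg b x₀) t)
      = ∫⁻ w, (if ∑ i, g (w i).1 ≤ b then F w else 0) ∂(historyLaw M a t) := by
  induction t with
  | zero => rfl
  | succ t ih =>
    have hF' := measurable_ite_sum_le hg b hF
    have hFM : Measurable fun z : (Fin t → Round D O) × D ↦ ∫⁻ y,
        (if ∑ i, g ((Fin.snoc z.1 (z.2, y) : Fin (t + 1) → Round D O) i).1 ≤ b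
          then F (Fin.snoc z.1 (z.2, y)) else 0) ∂(M.kernel z.2) :=
      Measurable.lintegral_kernel_prod_right' (κ := M.kernel.comap Prod.snd measurable_snd)
        (hF'.comp (measurable_snoc_assoc t))
    have hrec : ∀ a' : Algorithm D O, ∫⁻ w, (if ∑ i, g (w i).1 ≤ b then F w else 0)
        ∂(historyLaw M a' (t + 1)) = ∫⁻ w, (if ∑ i, g (w i).1 ≤ b then ∫⁻ x, ∫⁻ y,
          (if ∑ i, g ((Fin.snoc w (x, y) : Fin (t + 1) → Round D O) i).1 ≤ b
            then F (Fin.snoc w (x, y)) else 0) ∂(M.kernel x) ∂(a'.policy t w) else 0)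
          ∂(historyLaw M a' t) := by
      intro a'
      rw [lintegral_historyLaw_succ _ _ _ hF', Measure.lintegral_compProd hFM]
      refine lintegral_congr fun w ↦ ?_
      split_ifs with h
      · rfl
      -- As g is nonnegative, a budget once exceeded stays exceeded.
      · have : ∀ x y, ¬ ∑ i, g ((Fin.snoc w (x, y) : Fin (t + 1) → Round D O) i).1 ≤ b := by
          intro x y
          simp only [Fin.sum_univ_castSucc, Fin.snoc_castSucc, Fin.snoc_last]
          have := hg0 x
          intro h'
          exact h (by linarith)
        simp [this]
    have hA : Measurable fun w ↦ ∫⁻ x, ∫⁻ y,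
          (if ∑ i, g ((Fin.snoc w (x, y) : Fin (t + 1) → Round D O) i).1 ≤ b
            then F (Fin.snoc w (x, y)) else 0) ∂(M.kernel x) ∂(a.policy t w) :=
      hFM.lintegral_kernel_prod_right' (κ := a.policy t)
    rw [hrec a, ← ih hA, hrec (a.stopAt hg b x₀)]
    refine lintegral_congr fun w ↦ ?_
    split_ifs with h
    · rw [Algorithm.stopAt_policy_of_le h]
    · rfl

theorem lintegral_stoppedSum_succ (M : Model D O) (a : Algorithm D O) (hg : Measurable g)
    (hg' : Measurable g') (hg'0 : ∀ x, 0 ≤ g' x) (t : ℕ) :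
    ∫⁻ w, ENNReal.ofReal (stoppedSum g g' b (t + 1) w) ∂(historyLaw M a (t + 1))
      = ∫⁻ w, ENNReal.ofReal (stoppedSum g g' b t w) ∂(historyLaw M a t)
        + ∫⁻ w, (if ∑ i, g (w i).1 ≤ b then ∫⁻ x, ENNReal.ofReal (g' x) ∂(a.policy t w) else 0)
          ∂(historyLaw M a t) := by
  have hm := (measurable_stoppedSum (X := unitInterval × O) (b := b) hg hg' t).ennreal_ofReal
  have hm2 : Measurable fun z : (Fin t → Round D O) × D ↦
      if ∑ i, g (z.1 i).1 ≤ b then ENNReal.ofReal (g' z.2) else 0 :=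
    Measurable.ite (measurableSet_le ((measurable_sum_decision (O := O) hg t).comp measurable_fst)
      measurable_const) (hg'.comp measurable_snd).ennreal_ofReal measurable_const
  rw [lintegral_historyLaw_succ _ _ _ (measurable_stoppedSum hg hg' _).ennreal_ofReal]
  simp only [stoppedSum_snoc, lintegral_const, measure_univ, mul_one]
  have : ∀ z : (Fin t → Round D O) × D, ENNReal.ofReal (stoppedSum g g' b t z.1 +
      if ∑ i, g (z.1 i).1 ≤ b then g' z.2 else 0) = ENNReal.ofReal (stoppedSum g g' b t z.1) +
        if ∑ i, g (z.1 i).1 ≤ b then ENNReal.ofReal (g' z.2) else 0 := by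
    intro z
    rw [ENNReal.ofReal_add (stoppedSum_nonneg hg'0 _ _) (by split_ifs; exacts [hg'0 _, le_rfl])]
    split_ifs <;> simp
  simp_rw [this]
  rw [lintegral_add_right _ hm2, lintegral_fst_compProd hm, Measure.lintegral_compProd hm2]
  congr 1
  refine lintegral_congr fun w ↦ ?_
  dsimp only
  split_ifs <;> simp

/-- Each increment lives on the event that the budget still holds, where both algorithms have the
same histories and the same policy. -/
theorem lintegral_stoppedSum_stopAt (M : Model D O) (hg0 : ∀ x, 0 ≤ g x) (hg' : Measurable g')
    (hg'0 : ∀ x, 0 ≤ g' x) (t : ℕ) :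
    ∫⁻ w, ENNReal.ofReal (stoppedSum g g' b t w) ∂(historyLaw M (a.stopAt hg b x₀) t)
      = ∫⁻ w, ENNReal.ofReal (stoppedSum g g' b t w) ∂(historyLaw M a t) := by
  induction t with
  | zero => rfl
  | succ t ih =>
    rw [lintegral_stoppedSum_succ _ _ hg hg' hg'0, lintegral_stoppedSum_succ _ _ hg hg' hg'0, ih]
    congr 1
    have hm : Measurable fun w ↦ ∫⁻ x, ENNReal.ofReal (g' x) ∂(a.policy t w) :=
      hg'.ennreal_ofReal.lintegral_kernel
    rw [← lintegral_stopAt (hg := hg) (x₀ := x₀) M hg0 hm]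
    refine lintegral_congr fun w ↦ ?_
    split_ifs with h
    · rw [Algorithm.stopAt_policy_of_le h]
    · rfl

theorem lintegral_decisionMeasure_stopAt_le (M : Model D O) (hg0 : ∀ x, 0 ≤ g x) (t : ℕ) :
    ∫⁻ x, ENNReal.ofReal (g x) ∂(decisionMeasure M (a.stopAt hg b x₀) t)
      ≤ ∫⁻ w, ENNReal.ofReal (stoppedSum g g b t w) ∂(historyLaw M (a.stopAt hg b x₀) t)
        + t * ENNReal.ofReal (g x₀) := by
  induction t with
  | zero => simp [decisionMeasure]
  | succ t ih =>
    rw [decisionMeasure, Finset.sum_range_succ, ← decisionMeasure, lintegral_add_measure,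
      lintegral_snd_compProd hg.ennreal_ofReal,
      lintegral_stoppedSum_succ _ _ hg hg hg0]
    have : ∫⁻ w, ∫⁻ x, ENNReal.ofReal (g x) ∂((a.stopAt hg b x₀).policy t w)
          ∂(historyLaw M (a.stopAt hg b x₀) t)
        ≤ ∫⁻ w, (if ∑ i, g (w i).1 ≤ b
            then ∫⁻ x, ENNReal.ofReal (g x) ∂((a.stopAt hg b x₀).policy t w) else 0)
          ∂(historyLaw M (a.stopAt hg b x₀) t) + ENNReal.ofReal (g x₀) := by
      calc _ ≤ ∫⁻ w, ((if ∑ i, g (w i).1 ≤ b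
            then ∫⁻ x, ENNReal.ofReal (g x) ∂((a.stopAt hg b x₀).policy t w) else 0)
              + ENNReal.ofReal (g x₀)) ∂(historyLaw M (a.stopAt hg b x₀) t) := by
            refine lintegral_mono fun w ↦ ?_
            split_ifs with h
            · exact le_self_add
            · rw [Algorithm.stopAt_policy_of_lt (not_le.1 h),
                lintegral_dirac' _ hg.ennreal_ofReal, zero_add]
        _ = _ := by rw [lintegral_add_right _ measurable_const]; simp
    refine (add_le_add ih this).trans (le_of_eq ?_)
    push_cast
    ring

end Regret

/-! ### The lower bound relative to one reference model. -/

section LowerBound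

variable {D O : Type*} [MeasurableSpace D] [MeasurableSpace O]

theorem integral_gap_le_one (M : Model D O) (p : ProbabilityMeasure D) :
    ∫ x, M.gap x ∂(p : Measure D) ≤ 1 := by
  have := integral_mono (M.integrable_gap (p : Measure D)) (integrable_const (1 : ℝ)) M.gap_le_one
  rw [integral_const, probReal_univ, one_smul] at this
  exact this

theorem iSup_integral_gap_nonneg {ι : Type*} (M : ι → Model D O) (p : ProbabilityMeasure D) :
    0 ≤ ⨆ i, ∫ x, (M i).gap x ∂(p : Measure D) :=
  Real.iSup_nonneg fun i ↦ integral_nonneg (M i).gap_nonneg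

theorem decRegAt_le (ε : ℝ) (𝓜 : Set (Model D O)) (N : Model D O) (p : ProbabilityMeasure D) :
    decRegAt ε 𝓜 N ≤
      ⨆ M : {M : Model D O // M ∈ 𝓜 ∧ expHellingerSq p M N ≤ ENNReal.ofReal (ε ^ 2)},
        ∫ x, M.1.gap x ∂(p : Measure D) :=
  ciInf_le ⟨0, by rintro _ ⟨q, rfl⟩; exact iSup_integral_gap_nonneg _ q⟩ p

theorem decRegAt_nonneg (ε : ℝ) (𝓜 : Set (Model D O)) (N : Model D O) : 0 ≤ decRegAt ε 𝓜 N :=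
  Real.iInf_nonneg fun p ↦ iSup_integral_gap_nonneg _ p

/-- This bound is what makes the real supremum over reference models a genuine one. -/
theorem decRegAt_le_one (ε : ℝ) (𝓜 : Set (Model D O)) (N : Model D O) : decRegAt ε 𝓜 N ≤ 1 := by
  rcases isEmpty_or_nonempty (ProbabilityMeasure D) with h | ⟨⟨p⟩⟩
  · simp [decRegAt]
  · exact (decRegAt_le ε 𝓜 N p).trans
      (Real.iSup_le (fun M ↦ integral_gap_le_one M.1 p) zero_le_one)

/-- A distribution over decisions admits a nearby model with large expected suboptimality. -/
theorem exists_lt_integral_gap {ε : ℝ} {𝓜 : Set (Model D O)} {N : Model D O}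
    (p : ProbabilityMeasure D) {s : ℝ} (hs0 : 0 ≤ s) (hs : s < decRegAt ε 𝓜 N) :
    ∃ M ∈ 𝓜, expHellingerSq p M N ≤ ENNReal.ofReal (ε ^ 2) ∧
      s < ∫ x, M.gap x ∂(p : Measure D) := by
  by_contra! hcon
  have := Real.iSup_le (f := fun M : {M : Model D O // M ∈ 𝓜 ∧
    expHellingerSq p M N ≤ ENNReal.ofReal (ε ^ 2)} ↦ ∫ x, M.1.gap x ∂(p : Measure D))
    (fun M ↦ hcon M.1 M.2.1 M.2.2) hs0
  exact absurd (hs.trans_le ((decRegAt_le ε 𝓜 N p).trans this)) (lt_irrefl _)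

theorem decReg_le_decRegAll (ε : ℝ) (𝓜 : Set (Model D O)) : decReg ε 𝓜 ≤ decRegAll ε 𝓜 := by
  have hb : BddAbove (Set.range fun N : Model D O ↦ decRegAt ε (𝓜 ∪ {N}) N) :=
    ⟨1, by rintro _ ⟨N, rfl⟩; exact decRegAt_le_one _ _ _⟩
  exact Real.iSup_le (fun N ↦ le_ciSup hb N.1) (Real.iSup_nonneg fun N ↦ decRegAt_nonneg _ _ _)

theorem exists_lt_decRegAt {ε : ℝ} {𝓜 : Set (Model D O)} {s : ℝ} (hs0 : 0 ≤ s)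
    (hs : s < decRegAll ε 𝓜) : ∃ N : Model D O, s < decRegAt ε (𝓜 ∪ {N}) N := by
  by_contra! hcon
  exact absurd (hs.trans_le (Real.iSup_le hcon hs0)) (lt_irrefl _)

/-- The average law of the decisions over the first `T` rounds. -/
noncomputable def averageDecision (M : Model D O) (a : Algorithm D O) (T : ℕ) (hT : T ≠ 0) :
    ProbabilityMeasure D :=
  ⟨(T : ℝ≥0∞)⁻¹ • decisionMeasure M a T, ⟨by
    rw [Measure.smul_apply, decisionMeasure_univ, smul_eq_mul]
    exact ENNReal.inv_mul_cancel (by exact_mod_cast hT) (by simp)⟩⟩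

theorem integral_averageDecision (M : Model D O) (a : Algorithm D O) {T : ℕ} (hT : T ≠ 0)
    (G : D → ℝ) : T * ∫ x, G x ∂(averageDecision M a T hT : Measure D)
      = ∫ x, G x ∂(decisionMeasure M a T) := by
  have : (T : ℝ) ≠ 0 := by exact_mod_cast hT
  change T * ∫ x, G x ∂((T : ℝ≥0∞)⁻¹ • decisionMeasure M a T) = _
  rw [integral_smul_measure, ENNReal.toReal_inv, ENNReal.toReal_natCast, smul_eq_mul,
    mul_inv_cancel_left₀ this]

theorem lintegral_hellingerSq_le (M N : Model D O) (a : Algorithm D O) {T : ℕ} (hT : T ≠ 0)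
    {ε : ℝ} (h : expHellingerSq (averageDecision N a T hT) M N ≤ ENNReal.ofReal (ε ^ 2)) :
    ∫⁻ x, hellingerSq (M.kernel x) (N.kernel x) ∂(decisionMeasure N a T)
      ≤ ENNReal.ofReal (T * ε ^ 2) := by
  change ∫⁻ x, hellingerSq (M.kernel x) (N.kernel x) ∂((T : ℝ≥0∞)⁻¹ • decisionMeasure N a T) ≤ _
    at h
  rw [lintegral_smul_measure, smul_eq_mul] at h
  rw [ENNReal.ofReal_mul (Nat.cast_nonneg _), ENNReal.ofReal_natCast]
  calc _ = (T : ℝ≥0∞) * ((T : ℝ≥0∞)⁻¹ *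
        ∫⁻ x, hellingerSq (M.kernel x) (N.kernel x) ∂(decisionMeasure N a T)) := by
        rw [← mul_assoc, ENNReal.mul_inv_cancel (by exact_mod_cast hT) (by simp), one_mul]
    _ ≤ _ := by gcongr

/-- Mean rewards of models that are close in Hellinger distance are close on average. -/
theorem integral_abs_meanReward_sub_le (M N : Model D O) (μ : Measure D) {n ε : ℝ} (hε : 0 < ε)
    (hn : 0 ≤ n) (hμ : μ Set.univ = ENNReal.ofReal n)
    (h : ∫⁻ x, hellingerSq (M.kernel x) (N.kernel x) ∂μ ≤ ENNReal.ofReal (n * ε ^ 2)) :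
    ∫ x, |M.meanReward x - N.meanReward x| ∂μ ≤ 2 * ε * n := by
  have hm : Measurable fun x ↦ |M.meanReward x - N.meanReward x| :=
    (M.measurable_meanReward.sub N.measurable_meanReward).abs
  rw [integral_eq_lintegral_of_nonneg_ae (.of_forall fun x ↦ abs_nonneg _) hm.aestronglyMeasurable]
  refine ENNReal.toReal_le_of_le_ofReal (by positivity) ?_
  -- The choice l = 2 / ε balances the two terms, each contributing εn.
  calc ∫⁻ x, ENNReal.ofReal |M.meanReward x - N.meanReward x| ∂μ
      ≤ ∫⁻ x, (ENNReal.ofReal (2 / ε / 2) * hellingerSq (M.kernel x) (N.kernel x)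
          + ENNReal.ofReal (2 / (2 / ε))) ∂μ := by
        refine lintegral_mono fun x ↦ ?_
        exact ofReal_abs_integral_sub_le_hellingerSq (M.kernel x) (N.kernel x)
          (F := fun y ↦ (y.1 : ℝ)) measurable_fst.subtype_val
          (fun y ↦ by rw [abs_of_nonneg y.1.2.1]; exact y.1.2.2) (by positivity)
    _ = ENNReal.ofReal (2 / ε / 2) * ∫⁻ x, hellingerSq (M.kernel x) (N.kernel x) ∂μ
          + ENNReal.ofReal (2 / (2 / ε)) * ENNReal.ofReal n := by
        rw [lintegral_add_right _ measurable_const, lintegral_const_mul' _ _ ENNReal.ofReal_ne_top,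
          lintegral_const, hμ]
    _ ≤ ENNReal.ofReal (2 / ε / 2) * ENNReal.ofReal (n * ε ^ 2)
          + ENNReal.ofReal (2 / (2 / ε)) * ENNReal.ofReal n := by gcongr
    _ = ENNReal.ofReal (2 * ε * n) := by
        rw [← ENNReal.ofReal_mul (by positivity), ← ENNReal.ofReal_mul (by positivity),
          ← ENNReal.ofReal_add (by positivity) (by positivity)]
        congr 1
        field_simp
        ring

/-- Lower bound on the regret in terms of the decision-estimation coefficient relative to a fixed
reference model. -/
theorem exists_mem_le_expectedRegret {𝓜 : Set (Model D O)} {N : Model D O} {ε Δ : ℝ} {T : ℕ}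
    (hε : 0 < ε) (hΔ : decRegAt ε (𝓜 ∪ {N}) N = Δ) (hΔT : 16 ≤ Δ * T) (hεΔ : 80 * ε ≤ Δ)
    (hTε : T * ε ^ 2 ≤ 1 / 10000) (a : Algorithm D O) :
    ∃ M ∈ 𝓜, Δ * T / 16 ≤ expectedRegret M a T := by
  have hΔ0 : 0 < Δ := by linarith
  have hT : T ≠ 0 := by rintro rfl; norm_num at hΔT
  have hT0 : (0 : ℝ) < T := by exact_mod_cast Nat.pos_of_ne_zero hT
  have hD : Nonempty D := by
    by_contra hne
    rw [not_nonempty_iff] at hne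
    have : IsEmpty (ProbabilityMeasure D) := ⟨fun p ↦ (nonempty_of_isProbabilityMeasure
      (p : Measure D)).elim hne.elim⟩
    have : decRegAt ε (𝓜 ∪ {N}) N = 0 := Real.iInf_of_isEmpty _
    linarith
  obtain ⟨x₀, hx₀⟩ := N.exists_gap_le (η := Δ / 16) (by positivity)
  set B := Δ * T / 4 with hB
  have hB0 : 0 < B := by positivity
  set a' := a.stopAt N.measurable_gap B x₀ with ha'
  -- Before stopping the cost is at most B + 1, with 1 ≤ ΔT/16 by `hΔT`; afterwards it is at most
  -- Δ/16 per round.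
  have hgapN : ∫ x, N.gap x ∂(decisionMeasure N a' T) ≤ 3 / 8 * Δ * T := by
    rw [integral_eq_lintegral_of_nonneg_ae (.of_forall N.gap_nonneg)
      N.measurable_gap.aestronglyMeasurable]
    refine ENNReal.toReal_le_of_le_ofReal (by positivity) ?_
    refine (lintegral_decisionMeasure_stopAt_le N N.gap_nonneg T).trans ?_
    calc _ ≤ ∫⁻ _w, ENNReal.ofReal (B + 1) ∂(historyLaw N a' T)
          + T * ENNReal.ofReal (Δ / 16) := by
          gcongr with w
          exact stoppedSum_self_le N.gap_nonneg N.gap_le_one hB0.le T w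
      _ = ENNReal.ofReal (B + 1 + T * (Δ / 16)) := by
          rw [lintegral_const, measure_univ, mul_one,
            ENNReal.ofReal_add (p := B + 1) (by positivity) (by positivity),
            ENNReal.ofReal_mul hT0.le, ENNReal.ofReal_natCast]
      _ ≤ _ := ENNReal.ofReal_le_ofReal (by rw [hB]; linarith)
  obtain ⟨M, hM, hH, hgap⟩ := exists_lt_integral_gap (averageDecision N a' T hT)
    (s := 7 / 8 * Δ) (by positivity) (by rw [hΔ]; linarith)
  have hgapM : 7 / 8 * Δ * T ≤ ∫ x, M.gap x ∂(decisionMeasure N a' T) := by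
    rw [← integral_averageDecision N a' hT, mul_comm]
    exact mul_le_mul_of_nonneg_left hgap.le hT0.le
  -- If M were N, its total gap would be both at least 7ΔT/8 and at most 3ΔT/8.
  have hMN : M ∈ 𝓜 := by
    rcases hM with hM | rfl
    · exact hM
    · nlinarith
  refine ⟨M, hMN, ?_⟩
  have hdist := lintegral_hellingerSq_le M N a' hT hH
  set e : D → ℝ := fun x ↦ |M.meanReward x - N.meanReward x| with he
  have he0 : ∀ x, 0 ≤ e x := fun x ↦ abs_nonneg _
  have hem : Measurable e := (M.measurable_meanReward.sub N.measurable_meanReward).abs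
  have hei : Integrable e (decisionMeasure N a' T) := by
    refine Integrable.of_bound hem.aestronglyMeasurable 1 (.of_forall fun x ↦ ?_)
    rw [Real.norm_eq_abs, abs_of_nonneg (he0 x), he, abs_le]
    have := M.meanReward_nonneg x
    have := M.meanReward_le_one x
    have := N.meanReward_nonneg x
    have := N.meanReward_le_one x
    constructor <;> linarith
  have heb : ∫ x, e x ∂(decisionMeasure N a' T) ≤ 2 * ε * T :=
    integral_abs_meanReward_sub_le M N _ hε hT0.le
      (by rw [decisionMeasure_univ, ENNReal.ofReal_natCast]) hdist
  set c := (⨆ x, M.meanReward x) - ⨆ x, N.meanReward x with hc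
  have hpt : ∀ x, M.gap x ≤ c + N.gap x + e x ∧ N.gap x + c ≤ M.gap x + e x := by
    intro x
    have h1 := le_abs_self (M.meanReward x - N.meanReward x)
    have h2 := neg_abs_le (M.meanReward x - N.meanReward x)
    simp only [Model.gap, hc, he]
    constructor <;> linarith
  -- Per round, 7/8 ≤ c/Δ + 3/8 + 2ε/Δ, and 2ε/Δ ≤ 1/40.
  have hcΔ : Δ / 4 ≤ c := by
    have h1 : ∫ x, M.gap x ∂(decisionMeasure N a' T)
        ≤ ∫ x, (c + N.gap x + e x) ∂(decisionMeasure N a' T) :=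
      integral_mono (M.integrable_gap _)
        (((integrable_const _).add (N.integrable_gap _)).add hei) fun x ↦ (hpt x).1
    have hi : Integrable (fun x ↦ c + N.gap x) (decisionMeasure N a' T) :=
      (integrable_const _).add (N.integrable_gap _)
    rw [integral_add hi hei, integral_add (integrable_const _) (N.integrable_gap _),
      integral_const, Measure.real, decisionMeasure_univ, ENNReal.toReal_natCast,
      smul_eq_mul] at h1
    have h2 : Δ / 4 * T ≤ c * T := by nlinarith
    exact le_of_mul_le_mul_right h2 hT0
  set S : (Fin T → Round D O) → ℝ := stoppedSum N.gap M.gap B T with hS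
  have hSm : Measurable S := measurable_stoppedSum N.measurable_gap M.measurable_gap T
  have hS0 : ∀ w, 0 ≤ S w := stoppedSum_nonneg M.gap_nonneg T
  have hSle : ∀ w, S w ≤ ∑ i, M.gap (w i).1 := stoppedSum_le_sum M.gap_nonneg T
  have hsumi : ∀ a₀ : Algorithm D O,
      Integrable (fun w : Fin T → Round D O ↦ ∑ i, M.gap (w i).1) (historyLaw M a₀ T) := by
    intro a₀
    refine Integrable.of_bound (measurable_sum_decision M.measurable_gap T).aestronglyMeasurable
      T (.of_forall fun w ↦ ?_)
    rw [Real.norm_eq_abs, abs_of_nonneg (Finset.sum_nonneg fun i _ ↦ M.gap_nonneg _)]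
    calc ∑ i, M.gap (w i).1 ≤ ∑ _i : Fin T, (1 : ℝ) :=
          Finset.sum_le_sum fun i _ ↦ M.gap_le_one _
      _ = T := by simp
  have hSi : ∀ a₀ : Algorithm D O, Integrable S (historyLaw M a₀ T) := fun a₀ ↦
    (hsumi a₀).mono' hSm.aestronglyMeasurable (.of_forall fun w ↦ by
      rw [Real.norm_eq_abs, abs_of_nonneg (hS0 w)]; exact hSle w)
  have hSreg : ∫ w, S w ∂(historyLaw M a' T) ≤ expectedRegret M a T := by
    rw [expectedRegret_eq_integral_sum_gap,
      integral_eq_lintegral_of_nonneg_ae (.of_forall hS0) hSm.aestronglyMeasurable, hS,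
      lintegral_stoppedSum_stopAt M N.gap_nonneg M.measurable_gap M.gap_nonneg,
      ← integral_eq_lintegral_of_nonneg_ae (.of_forall hS0) hSm.aestronglyMeasurable]
    exact integral_mono (hSi a) (hsumi a) hSle
  -- Truncation gives a statistic bounded by 1, as the change of measure requires.
  set F : (Fin T → Round D O) → ℝ := fun w ↦ min (S w / B) 1 with hF
  have hFm : Measurable F := (hSm.div_const _).min measurable_const
  have hF0 : ∀ w, 0 ≤ F w := fun w ↦ le_min (div_nonneg (hS0 w) hB0.le) zero_le_one
  have hF1 : ∀ w, |F w| ≤ 1 := fun w ↦ by rw [abs_of_nonneg (hF0 w)]; exact min_le_right _ _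
  have hFi : ∀ M' : Model D O, Integrable F (historyLaw M' a' T) := fun M' ↦
    Integrable.of_bound hFm.aestronglyMeasurable 1 (.of_forall hF1)
  -- The value l = 100 = 1/√δ minimizes 1/l + lδ, giving 1/50, and m = 14 nearly minimizes m/100 +
  -- 2/m. The error is about 0.283, less than 9/10 - 1/2.
  have hclose := abs_integral_historyLaw_sub_le M N a' T (δ := 1 / 10000) (by norm_num)
    (hdist.trans (ENNReal.ofReal_le_ofReal hTε)) hFm hF1 (l := 100) (m := 14) (by norm_num)
    (by norm_num)
  have hFN : 9 / 10 ≤ ∫ w, F w ∂(historyLaw N a' T) := by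
    have hlow : ∀ w, 1 - (∑ i, e (w i).1) / B ≤ F w := by
      intro w
      have h0 : 0 ≤ ∑ i, e (w i).1 := Finset.sum_nonneg fun i _ ↦ he0 _
      refine le_min ?_ (by linarith [div_nonneg h0 hB0.le])
      have hmin := le_stoppedSum_add_sum (b := B) (c := Δ / 4) (by positivity) N.gap_nonneg
        M.gap_nonneg he0 (fun x ↦ by linarith [(hpt x).2]) T w
      rw [min_eq_left (by rw [hB]; linarith)] at hmin
      rw [sub_le_iff_le_add, ← add_div, le_div_iff₀ hB0, one_mul]
      exact hmin
    have hesi : Integrable (fun w : Fin T → Round D O ↦ ∑ i, e (w i).1) (historyLaw N a' T) := by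
      have hm := measurable_sum_decision (O := O) hem T
      have h0 : ∀ w : Fin T → Round D O, 0 ≤ ∑ i, e (w i).1 := fun w ↦
        Finset.sum_nonneg fun i _ ↦ he0 _
      refine ⟨hm.aestronglyMeasurable, ?_⟩
      rw [hasFiniteIntegral_iff_ofReal (.of_forall h0)]
      simp_rw [ENNReal.ofReal_sum_of_nonneg fun i _ ↦ he0 _]
      rw [lintegral_sum_decision _ _ _ hem.ennreal_ofReal]
      exact (hasFiniteIntegral_iff_ofReal (.of_forall he0)).1 hei.2
    have h1 : ∫ w, (1 - (∑ i, e (w i).1) / B) ∂(historyLaw N a' T)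
        ≤ ∫ w, F w ∂(historyLaw N a' T) :=
      integral_mono ((integrable_const _).sub (hesi.div_const _)) (hFi N) hlow
    rw [integral_sub (integrable_const _) (hesi.div_const _), integral_const, probReal_univ,
      one_smul, integral_div, integral_sum_decision _ _ _ hem he0] at h1
    -- Indeed 2εT ≤ ΔT/40 = B/10 by `hεΔ`.
    have h2 : (∫ x, e x ∂(decisionMeasure N a' T)) / B ≤ 1 / 10 := by
      rw [div_le_iff₀ hB0, hB]
      nlinarith
    linarith
  have hFM : 1 / 2 ≤ ∫ w, F w ∂(historyLaw M a' T) := by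
    have := (abs_le.1 hclose).1
    norm_num at this
    linarith
  have hFS : ∫ w, F w ∂(historyLaw M a' T) ≤ (∫ w, S w ∂(historyLaw M a' T)) / B := by
    rw [← integral_div]
    exact integral_mono (hFi M) ((hSi a').div_const _) fun w ↦ min_le_left _ _
  have h3 := hFM.trans hFS
  rw [le_div_iff₀ hB0, hB] at h3
  nlinarith

end LowerBound

/-! ### Constants and conclusion. -/

theorem two_le_toReal_min {D O : Type*} [MeasurableSpace D] [MeasurableSpace O]
    (𝓜 : Set (Model D O)) {T : ℕ} (hT : 2 ≤ T) :
    2 ≤ (min (T : ℝ≥0∞) (ratioBound 𝓜)).toReal ∧ (min (T : ℝ≥0∞) (ratioBound 𝓜)).toReal ≤ T := by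
  have hne : min (T : ℝ≥0∞) (ratioBound 𝓜) ≠ ∞ :=
    ne_top_of_le_ne_top (ENNReal.natCast_ne_top T) (min_le_left _ _)
  constructor
  · have h2 : (2 : ℝ≥0∞) ≤ min (T : ℝ≥0∞) (ratioBound 𝓜) := by
      refine le_min (by exact_mod_cast hT) (le_trans ?_ le_sup_right)
      rw [← ENNReal.ofReal_ofNat 2]
      exact ENNReal.ofReal_le_ofReal (by linarith [Real.add_one_le_exp 1])
    simpa using ENNReal.toReal_mono hne h2
  · simpa using ENNReal.toReal_mono (ENNReal.natCast_ne_top T)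
      (min_le_left (T : ℝ≥0∞) (ratioBound 𝓜))

end DMSO

theorem theorem2p2 :
    ∃ C C' c c' : ℝ, 0 < C ∧ 0 < C' ∧ 0 < c ∧ 0 < c' ∧
      ∀ (D O : Type*) [MeasurableSpace D] [MeasurableSpace O]
        (𝓜 : Set (DMSO.Model D O)) (T : ℕ) (ε : ℝ),
        2 ≤ T →
        ε = c / √(T * DMSO.logFactor T 𝓜) →
        C * ε ≤ DMSO.decReg ε 𝓜 →
        ∀ a : DMSO.Algorithm D O, ∃ M ∈ 𝓜,
          c' * DMSO.decRegAll ε 𝓜 * (T / Real.log T) - C' * (√T / Real.log T)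
              ≤ DMSO.expectedRegret M a T ∧
          c' * DMSO.decReg ε 𝓜 * (T / Real.log T) - C' * (√T / Real.log T)
              ≤ c' * DMSO.decRegAll ε 𝓜 * (T / Real.log T) - C' * (√T / Real.log T) := by
  -- Half of `decRegAll` is at least 3200ε and εT ≥ 1/200, which gives ΔT ≥ 16. In 1/64, the 16 is
  -- the loss of the fixed-reference bound, one factor 2 comes from the near-maximizing reference
  -- and one from T / log T ≤ 2T. The subtracted term is only discarded, so 1 is arbitrary.
  refine ⟨6400, 1, 1 / 200, 1 / 64, by norm_num, by norm_num, by norm_num, by norm_num, ?_⟩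
  intro D O _ _ 𝓜 T ε hT hε hdec a
  obtain ⟨hm2, hmT⟩ := DMSO.two_le_toReal_min 𝓜 hT
  have hT2 : (2 : ℝ) ≤ T := by exact_mod_cast hT
  set L := DMSO.logFactor T 𝓜 with hL
  have hlog2 : (0.69 : ℝ) < Real.log 2 := by linarith [Real.log_two_gt_d9]
  have hL1 : Real.log 2 ≤ L := Real.log_le_log (by norm_num) hm2
  have hL2 : L ≤ T := by
    refine (Real.log_le_log (by linarith) hmT).trans ?_
    linarith [Real.log_le_sub_one_of_pos (show (0 : ℝ) < T by linarith)]
  have hTL : 0 < T * L := by nlinarith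
  have hs0 : 0 < √(T * L) := Real.sqrt_pos.2 hTL
  have hε0 : 0 < ε := by rw [hε]; positivity
  have hεs : ε * √(T * L) = 1 / 200 := by rw [hε]; field_simp
  have hεT : 1 / 200 ≤ ε * T := by
    rw [← hεs]
    refine mul_le_mul_of_nonneg_left ?_ hε0.le
    rw [Real.sqrt_le_left (by linarith)]
    nlinarith
  -- Here Tε² = 1/(40000 L) and L ≥ log 2 > 0.69.
  have hTε : T * ε ^ 2 ≤ 1 / 10000 := by
    have h1 : ε ^ 2 * (T * L) = 1 / 40000 := by
      rw [← Real.sq_sqrt hTL.le, ← mul_pow, hεs]; norm_num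
    have h2 : 0 ≤ T * ε ^ 2 := by positivity
    nlinarith
  have hle := DMSO.decReg_le_decRegAll ε 𝓜
  have hlogT : Real.log 2 ≤ Real.log T := Real.log_le_log (by norm_num) hT2
  have hlogT0 : 0 < Real.log T := by linarith
  obtain ⟨N, hN⟩ := DMSO.exists_lt_decRegAt (ε := ε) (𝓜 := 𝓜)
    (s := DMSO.decRegAll ε 𝓜 / 2) (by linarith) (by linarith)
  obtain ⟨M, hM, hreg⟩ := DMSO.exists_mem_le_expectedRegret hε0
    (rfl : _ = DMSO.decRegAt ε (𝓜 ∪ {N}) N) (by nlinarith) (by linarith) hTε a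
  refine ⟨M, hM, ?_, ?_⟩
  · have h1 : T / Real.log T ≤ 2 * T := by
      rw [div_le_iff₀ hlogT0]; nlinarith
    have h2 : 0 ≤ √(T : ℝ) / Real.log T := by positivity
    have h3 : 0 ≤ DMSO.decRegAll ε 𝓜 := by linarith
    have h4 := mul_le_mul_of_nonneg_left h1 (show 0 ≤ 1 / 64 * DMSO.decRegAll ε 𝓜 by positivity)
    nlinarith
  · gcongr
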